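/- **Lemma 3.1 (Weighted uniform estimates).** For $\varepsilon>0$ and a sign $\sigma\in\{+1,-1\}$ let $V_\varepsilon(x)=\sigma\,\tfrac12|x|e^{-\varepsilon|x|}$, $x\in\mathbb R$, and write $\langle x\rangle=\sqrt{1+x^2}$. For every $C_0\ge 0$ and every $T\ge 0$ there are finite constants $C$, $D_k$ $(k\ge 0)$ and $D'_k$ $(k\ge1)$, depending only on $C_0$, $T$ (and $k$), such that the following holds for both signs $\sigma$, all $\hbar\in(0,1]$ and all $\varepsilon>0$. Let $\psi^{\mathrm{in}}\in L^2(\mathbb R;\mathbb C)$ satisfy $$\|\psi^{\mathrm{in}}\|_{L^2}=1,\qquad \||x|\psi^{\mathrm{in}}\|_{L^2}\le C_0,\qquad \|\hbar^k\partial_x^k\psi^{\mathrm{in}}\|_{L^2}\le C_0^k k^k\quad\text{for all } k\ge0$$ (weak derivatives, with $0^0=1$), and let $\psi\in C([0,T];L^2(\mathbb R;\mathbb C))$ be a solution of the Hartree equation $$i\hbar\,\partial_t\psi=-\tfrac12\hbar^2\partial_x^2\psi+(V_\varepsilon*|\psi|^2)\psi,\qquad \psi(0)=\psi^{\mathrm{in}},$$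 in the sense that for every $\varphi\in C_c^\infty(\mathbb R;\mathbb C)$ the function $t\mapsto\int\psi(t)\varphi\,dx$ is differentiable on $[0,T]$ with $i\hbar\frac{d}{dt}\int\psi\varphi\,dx=\int\big(-\tfrac12\hbar^2\psi\,\varphi''+(V_\varepsilon*|\psi|^2)\psi\,\varphi\big)dx$. Then for all $t\in[0,T]$ all weak derivatives $\partial_x^k\psi(t)$ exist in $L^2$, and $$\|\langle x\rangle^2|\psi(t)|^2\|_{L^1}\le C,$$ $$\|\hbar^k\partial_x^k\psi(t)\|_{L^2}\le D_k\quad\text{for all }k\ge0,$$ $$\|\langle x\rangle^{1/2}\hbar^k\partial_x^k\psi(t)\|_{L^2}\le D'_k\quad\text{for all }k\ge1.$$ -/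

import Mathlib

open MeasureTheory Set
open scoped ENNReal NNReal ContDiff Convolution

noncomputable section

/-- The one-dimensional screened Coulomb potential `V_ε(x) = σ (1/2) |x| e^{-ε|x|}`; the sign is
`σ = 1` in the defocusing case and `σ = -1` in the focusing case. -/
def screenedCoulomb (σ ε : ℝ) (x : ℝ) : ℝ :=
  σ * (1 / 2 * |x| * Real.exp (-ε * |x|))

/-- The bracket `⟨x⟩ = √(1 + x²)`. -/
def bracket (x : ℝ) : ℝ := Real.sqrt (1 + x ^ 2)

/-- Test functions on the line: smooth (`C^∞`), compactly supported, complex-valued. -/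
def IsTestFunction (φ : ℝ → ℂ) : Prop :=
  ContDiff ℝ ∞ φ ∧ HasCompactSupport φ

/-- `g` is the `k`-th weak derivative of `u` on the line. -/
def HasWeakDeriv (k : ℕ) (u g : ℝ → ℂ) : Prop :=
  LocallyIntegrable u volume ∧ LocallyIntegrable g volume ∧
    ∀ φ : ℝ → ℂ, IsTestFunction φ →
      ∫ x, u x * iteratedDeriv k φ x = (-1) ^ k * ∫ x, g x * φ x

/-- The potential `V_ε * |u|²` generated by the density `|u|²`. -/
def hartreePotential (σ ε : ℝ) (u : ℝ → ℂ) : ℝ → ℝ :=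
  (screenedCoulomb σ ε) ⋆[ContinuousLinearMap.mul ℝ ℝ, volume] (fun x => ‖u x‖ ^ 2)

/-- `ψ ∈ C([0,T]; L²(ℝ))` is a (weak) solution of the Hartree equation
`iħ ∂ₜψ = -(ħ²/2) ∂ₓ²ψ + (V_ε * |ψ|²) ψ` with `ψ(0) = ψin`:
the equation is tested against smooth compactly supported functions of `x`. -/
structure IsHartreeSolution (σ ħ ε T : ℝ) (ψin : Lp ℂ 2 (volume : Measure ℝ))
    (ψ : ℝ → Lp ℂ 2 (volume : Measure ℝ)) : Prop where
  continuousOn : ContinuousOn ψ (Icc 0 T)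
  initial : ψ 0 = ψin
  equation : ∀ φ : ℝ → ℂ, IsTestFunction φ → ∀ t ∈ Icc 0 T,
    HasDerivWithinAt (fun s : ℝ => Complex.I * (ħ : ℂ) * ∫ x, ψ s x * φ x)
      (∫ x, (-(1 / 2) * (ħ : ℂ) ^ 2 * (ψ t x * iteratedDeriv 2 φ x)
        + (hartreePotential σ ε (ψ t) x : ℂ) * ψ t x * φ x))
      (Icc 0 T) t

/-- The assumptions on the initial datum, with constant `C₀`: it is normalized in `L²`,
`‖|x| ψin‖_{L²} ≤ C₀`, and `‖ħᵏ ∂ₓᵏ ψin‖_{L²} ≤ C₀ᵏ kᵏ` for all `k ≥ 0` (with `0⁰ = 1`). -/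
structure IsAdmissibleDatum (ħ : ℝ) (C₀ : ℝ≥0) (ψin : Lp ℂ 2 (volume : Measure ℝ)) : Prop where
  normalized : ‖ψin‖ = 1
  moment : eLpNorm (fun x : ℝ => ((|x| : ℝ) : ℂ) * ψin x) 2 volume ≤ C₀
  deriv_bound : ∀ k : ℕ, ∃ g : ℝ → ℂ, HasWeakDeriv k ψin g ∧
    eLpNorm (fun x : ℝ => (ħ : ℂ) ^ k * g x) 2 volume ≤ (C₀ : ℝ≥0∞) ^ k * (k : ℝ≥0∞) ^ k

end

/-!
The whole proof runs on difference quotients, so that no regularity of the solution has to be known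
in advance.

**Energy inequality** (`IsWeakSol.norm_le`). Let `u` be a weak solution of
`iħ ∂ₜu = -(ħ²/2) ∂ₓ²u + W u + F` with `W` real and Lipschitz in `x`. Regularizing by the double
Steklov average `avg d (avg (-d) ·)` turns the Laplacian into a bounded second difference, whose
contribution to `d/dt ‖·‖²` is real and drops out; the average commutes with `W` up to `O(d)`.
Letting `d → 0` gives `‖u(t)‖ ≤ ‖u(0)‖ + t sup ‖F‖ / ħ`. With `F = 0` this bounds the mass.

**Derivatives** (`IsHartreeSolution.norm_iterate_dq_le`). Apply the inequality to the iterated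
semiclassical difference quotients `dq ħ h = ħ (τ_h - 1) / h` of `ψ`. The source `F` is then the
commutator of `dq^k` with the potential `W = V * |ψ|²`, which sees only difference quotients of `W`
of positive order. One of these quotients is absorbed by `V`, which is `1/2`-Lipschitz for every
screening parameter, and yields a factor `ħ` that cancels the `1 / ħ` of the energy inequality; the
others fall on `|ψ|²` and are of order less than `k` (`norm_iterate_dqB_potential_le`). This gives a
recursion for constants uniform in `ħ`, in the screening parameter and in the step `h`, and weak
compactness as `h → 0` turns them into bounds on weak derivatives
(`exists_hasWeakDeriv_of_norm_iterate_dq_le`).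

**Moments** (`IsHartreeSolution.eLpNorm_moment_le`). With a bounded smooth weight `m` approximating
`x`, the function `m ψ` solves the same equation with source `(ħ²/2) (2 m' ∂ₓψ + m'' ψ)`, which is
`O(ħ)` by the bound on `ħ ∂ₓψ`. Fatou's lemma removes the cutoff.

**Half weights** (`eLpNorm_half_weight_le`). At a fixed time, `∫ ⟨x⟩ |(ħ∂ₓ)ᵏψ|²` is integrated by
parts until all derivatives are on one factor; the weight then goes with the undifferentiated one.
-/

noncomputable section

open Filter Topology ComplexConjugate
open scoped InnerProductSpace BoundedContinuousFunction

/-- The Hilbert space `L²(ℝ; ℂ)`. -/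
abbrev L2R : Type := Lp ℂ 2 (volume : Measure ℝ)

/-! ### Translations, averages and multiplication operators on `L²` -/

/-- The translation `u ↦ u(· + y)` as a linear isometry of `L²`. -/
def transl (y : ℝ) : L2R →ₗᵢ[ℂ] L2R :=
  Lp.compMeasurePreservingₗᵢ ℂ (fun x => x + y) (measurePreserving_add_right volume y)

lemma coeFn_transl (y : ℝ) (u : L2R) : transl y u =ᵐ[volume] fun x => u (x + y) :=
  Lp.coeFn_compMeasurePreserving u (measurePreserving_add_right volume y)

lemma ae_comp_add_right {p : ℝ → Prop} (hp : ∀ᵐ x ∂(volume : Measure ℝ), p x) (y : ℝ) :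
    ∀ᵐ x ∂(volume : Measure ℝ), p (x + y) :=
  (measurePreserving_add_right volume y).quasiMeasurePreserving.ae hp

lemma transl_transl (y z : ℝ) (u : L2R) : transl y (transl z u) = transl (y + z) u := by
  apply Lp.ext
  filter_upwards [coeFn_transl y (transl z u), ae_comp_add_right (coeFn_transl z u) y,
    coeFn_transl (y + z) u] with x h1 h2 h3
  rw [h1, h2, h3, add_assoc]

lemma transl_zero (u : L2R) : transl 0 u = u := by
  apply Lp.ext
  filter_upwards [coeFn_transl 0 u] with x h1
  simpa using h1

lemma transl_comm (y z : ℝ) (u : L2R) : transl y (transl z u) = transl z (transl y u) := by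
  rw [transl_transl, transl_transl, add_comm]

lemma transl_neg_transl (y : ℝ) (u : L2R) : transl (-y) (transl y u) = u := by
  rw [transl_transl, neg_add_cancel, transl_zero]

lemma inner_transl (y : ℝ) (u v : L2R) : ⟪u, transl y v⟫_ℂ = ⟪transl (-y) u, v⟫_ℂ := by
  rw [← (transl (-y)).inner_map_map u, transl_neg_transl]

lemma continuous_transl (u : L2R) : Continuous fun y => transl y u := by
  let g : ℝ → C(ℝ, ℝ) := fun y => ⟨fun x => x + y, by fun_prop⟩
  have hg : Continuous g := ContinuousMap.continuous_of_continuous_uncurry _ (by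
    simp only [g, Function.uncurry_def, ContinuousMap.coe_mk]; fun_prop)
  exact (continuous_const (y := u)).compMeasurePreservingLp hg
    (fun y => measurePreserving_add_right volume y) (by simp)

/-- The Steklov average `u ↦ ∫₀¹ u(· + r h) dr`. -/
def avg (h : ℝ) : L2R →L[ℂ] L2R :=
  LinearMap.mkContinuous
    { toFun := fun u => ∫ r in (0 : ℝ)..1, transl (r * h) u
      map_add' := fun u v => by
        simp only [map_add]
        exact intervalIntegral.integral_add
          (((continuous_transl u).comp (by fun_prop)).intervalIntegrable _ _)
          (((continuous_transl v).comp (by fun_prop)).intervalIntegrable _ _)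
      map_smul' := fun c u => by
        simp only [map_smul, RingHom.id_apply]
        exact intervalIntegral.integral_smul _ _ } 1 (fun u => by
    have := intervalIntegral.norm_integral_le_of_norm_le_const (a := (0 : ℝ)) (b := 1)
      (f := fun r => transl (r * h) u) (C := ‖u‖) (fun r _ => by simp)
    simpa using this)

lemma avg_apply (h : ℝ) (u : L2R) : avg h u = ∫ r in (0 : ℝ)..1, transl (r * h) u := rfl

lemma intervalIntegrable_transl (h : ℝ) (u : L2R) (a b : ℝ) :
    IntervalIntegrable (fun r : ℝ => transl (r * h) u) volume a b :=
  ((continuous_transl u).comp (by fun_prop : Continuous fun r : ℝ => r * h)).intervalIntegrable _ _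

lemma norm_avg_le (h : ℝ) (u : L2R) : ‖avg h u‖ ≤ ‖u‖ := by
  have := (avg h).le_of_opNorm_le (LinearMap.mkContinuous_norm_le _ zero_le_one _) u
  simpa using this

lemma norm_avg_sub_le {h C : ℝ} {u v : L2R}
    (H : ∀ r ∈ Icc (0 : ℝ) 1, ‖transl (r * h) u - v‖ ≤ C) : ‖avg h u - v‖ ≤ C := by
  have e : avg h u - v = ∫ r in (0 : ℝ)..1, (transl (r * h) u - v) := by
    rw [intervalIntegral.integral_sub (intervalIntegrable_transl h u _ _) (by simp), avg_apply]
    simp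
  rw [e]
  have := intervalIntegral.norm_integral_le_of_norm_le_const (a := (0 : ℝ)) (b := 1)
      (f := fun r => transl (r * h) u - v) (C := C) (fun r hr => by
        rw [uIoc_of_le zero_le_one] at hr
        exact H r ⟨hr.1.le, hr.2⟩)
  simpa using this

lemma avg_transl (h y : ℝ) (u : L2R) : avg h (transl y u) = transl y (avg h u) := by
  rw [avg_apply, avg_apply]
  have := (transl y).toContinuousLinearMap.intervalIntegral_comp_comm
    (intervalIntegrable_transl h u 0 1)
  simp only [LinearIsometry.coe_toContinuousLinearMap] at this
  rw [← this]
  simp only [transl_comm]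

lemma inner_avg (h : ℝ) (u v : L2R) : ⟪u, avg h v⟫_ℂ = ⟪avg (-h) u, v⟫_ℂ := by
  have h1 : ⟪u, avg h v⟫_ℂ = ∫ r in (0 : ℝ)..1, ⟪u, transl (r * h) v⟫_ℂ :=
    ((innerSL ℂ u).intervalIntegral_comp_comm (intervalIntegrable_transl h v 0 1)).symm
  have h2 : ⟪v, avg (-h) u⟫_ℂ = ∫ r in (0 : ℝ)..1, ⟪v, transl (r * -h) u⟫_ℂ :=
    ((innerSL ℂ v).intervalIntegral_comp_comm (intervalIntegrable_transl (-h) u 0 1)).symm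
  rw [← inner_conj_symm (avg (-h) u) v, h2, h1,
    intervalIntegral.integral_of_le zero_le_one, intervalIntegral.integral_of_le zero_le_one,
    ← integral_conj]
  congr 1
  ext r
  rw [inner_conj_symm, inner_transl]
  simp

/-- Averages over shrinking intervals converge strongly to the identity. -/
lemma tendsto_avg (u : L2R) : Tendsto (fun h => avg h u) (𝓝 0) (𝓝 u) := by
  rw [Metric.tendsto_nhds]
  intro e he
  have h0 : Tendsto (fun y => transl y u) (𝓝 0) (𝓝 u) := by
    simpa [transl_zero] using (continuous_transl u).tendsto 0
  obtain ⟨d, hd, H⟩ := Metric.tendsto_nhds_nhds.1 h0 (e / 2) (by positivity)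
  filter_upwards [Metric.ball_mem_nhds (0 : ℝ) hd] with h hh
  rw [dist_eq_norm]
  refine lt_of_le_of_lt (norm_avg_sub_le (C := e / 2) fun r hr => ?_) (by linarith)
  rw [← dist_eq_norm]
  refine (H ?_).le
  rw [Metric.mem_ball, dist_zero_right, Real.norm_eq_abs] at hh
  rw [dist_zero_right, Real.norm_eq_abs, abs_mul, abs_of_nonneg hr.1]
  nlinarith [hr.2, abs_nonneg h]

lemma memLp_bounded_mul (w : ℝ →ᵇ ℂ) (u : L2R) :
    MemLp (fun x => w x * u x) 2 volume :=
  (Lp.memLp u).of_le_mul (c := ‖w‖)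
    (w.continuous.aestronglyMeasurable.mul (Lp.aestronglyMeasurable u))
    (Eventually.of_forall fun x => by
      rw [norm_mul]
      exact mul_le_mul_of_nonneg_right (w.norm_coe_le_norm x) (norm_nonneg _))

/-- Multiplication by a bounded continuous function. -/
def mulOp (w : ℝ →ᵇ ℂ) : L2R →ₗ[ℂ] L2R where
  toFun u := (memLp_bounded_mul w u).toLp _
  map_add' u v := by
    apply Lp.ext
    filter_upwards [(memLp_bounded_mul w (u + v)).coeFn_toLp, (memLp_bounded_mul w u).coeFn_toLp,
      (memLp_bounded_mul w v).coeFn_toLp, Lp.coeFn_add u v,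
      Lp.coeFn_add ((memLp_bounded_mul w u).toLp _) ((memLp_bounded_mul w v).toLp _)]
      with x h1 h2 h3 h4 h5
    rw [h1, h5, Pi.add_apply, h2, h3, h4, Pi.add_apply, mul_add]
  map_smul' c u := by
    apply Lp.ext
    filter_upwards [(memLp_bounded_mul w (c • u)).coeFn_toLp, (memLp_bounded_mul w u).coeFn_toLp,
      Lp.coeFn_smul c u, Lp.coeFn_smul c ((memLp_bounded_mul w u).toLp _)] with x h1 h2 h3 h4
    rw [h1, RingHom.id_apply, h4, Pi.smul_apply, h2, h3, Pi.smul_apply, smul_eq_mul, smul_eq_mul]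
    ring

lemma coeFn_mulOp (w : ℝ →ᵇ ℂ) (u : L2R) : mulOp w u =ᵐ[volume] fun x => w x * u x :=
  (memLp_bounded_mul w u).coeFn_toLp

lemma norm_mulOp_le {w : ℝ →ᵇ ℂ} {C : ℝ} (hC : ∀ x, ‖w x‖ ≤ C) (u : L2R) :
    ‖mulOp w u‖ ≤ C * ‖u‖ := by
  apply Lp.norm_le_mul_norm_of_ae_le_mul
  filter_upwards [coeFn_mulOp w u] with x hx
  rw [hx, norm_mul]
  exact mul_le_mul_of_nonneg_right (hC x) (norm_nonneg _)

lemma mulOp_comm (w z : ℝ →ᵇ ℂ) (u : L2R) : mulOp w (mulOp z u) = mulOp z (mulOp w u) := by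
  apply Lp.ext
  filter_upwards [coeFn_mulOp w u, coeFn_mulOp z u, coeFn_mulOp w (mulOp z u),
    coeFn_mulOp z (mulOp w u)] with x h1 h2 h3 h4
  rw [h3, h4, h1, h2]; ring

lemma mulOp_sub_left (w z : ℝ →ᵇ ℂ) (u : L2R) : mulOp (w - z) u = mulOp w u - mulOp z u := by
  apply Lp.ext
  filter_upwards [coeFn_mulOp w u, coeFn_mulOp z u, coeFn_mulOp (w - z) u,
    Lp.coeFn_sub (mulOp w u) (mulOp z u)] with x h1 h2 h3 h4
  rw [h3, h4, Pi.sub_apply, h1, h2, BoundedContinuousFunction.sub_apply, sub_mul]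

lemma mulOp_smul_left (c : ℂ) (w : ℝ →ᵇ ℂ) (u : L2R) : mulOp (c • w) u = c • mulOp w u := by
  apply Lp.ext
  filter_upwards [coeFn_mulOp w u, coeFn_mulOp (c • w) u,
    Lp.coeFn_smul c (mulOp w u)] with x h1 h3 h4
  rw [h3, h4, Pi.smul_apply, h1, BoundedContinuousFunction.smul_apply, smul_eq_mul, smul_eq_mul,
    mul_assoc]

lemma L2R.inner_eq (u v : L2R) : ⟪u, v⟫_ℂ = ∫ x, v x * conj (u x) := rfl

/-- The adjoint of multiplication by `w` is multiplication by its conjugate. -/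
lemma inner_mulOp {w z : ℝ →ᵇ ℂ} (h : ∀ x, z x = conj (w x)) (u v : L2R) :
    ⟪u, mulOp w v⟫_ℂ = ⟪mulOp z u, v⟫_ℂ := by
  rw [L2R.inner_eq, L2R.inner_eq]
  apply integral_congr_ae
  filter_upwards [coeFn_mulOp w v, coeFn_mulOp z u] with x h1 h2
  rw [h1, h2, h x]; simp; ring

/-- The translate `w(· + y)` of a bounded continuous function. -/
def translB (y : ℝ) (w : ℝ →ᵇ ℂ) : ℝ →ᵇ ℂ := w.compContinuous ⟨fun x => x + y, by fun_prop⟩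

lemma translB_apply (y : ℝ) (w : ℝ →ᵇ ℂ) (x : ℝ) : translB y w x = w (x + y) := rfl

lemma transl_mulOp (y : ℝ) (w : ℝ →ᵇ ℂ) (u : L2R) :
    transl y (mulOp w u) = mulOp (translB y w) (transl y u) := by
  apply Lp.ext
  filter_upwards [coeFn_transl y (mulOp w u), ae_comp_add_right (coeFn_mulOp w u) y,
    coeFn_mulOp (translB y w) (transl y u), coeFn_transl y u] with x h1 h2 h3 h4
  rw [h1, h2, h3, h4, translB_apply]

/-- Averaging nearly commutes with multiplication by a Lipschitz function. -/
lemma norm_avg_mulOp_sub_le {w : ℝ →ᵇ ℂ} {K : ℝ} (hK : ∀ x y, ‖w x - w y‖ ≤ K * |x - y|)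
    (h : ℝ) (u : L2R) : ‖avg h (mulOp w u) - mulOp w (avg h u)‖ ≤ K * |h| * ‖u‖ := by
  have hK0 : 0 ≤ K := by
    have := (norm_nonneg _).trans (hK 1 0); simpa using this
  let M : L2R →L[ℂ] L2R := (mulOp w).mkContinuous ‖w‖ (norm_mulOp_le w.norm_coe_le_norm)
  have hM : ∀ v, M v = mulOp w v := fun v => rfl
  have e : avg h (mulOp w u) - mulOp w (avg h u)
      = ∫ r in (0 : ℝ)..1, (transl (r * h) (mulOp w u) - M (transl (r * h) u)) := by
    rw [intervalIntegral.integral_sub (intervalIntegrable_transl h _ _ _),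
      M.intervalIntegral_comp_comm (intervalIntegrable_transl h u 0 1), avg_apply, avg_apply, hM]
    exact (M.continuous.comp ((continuous_transl u).comp (by fun_prop))).intervalIntegrable _ _
  rw [e]
  have := intervalIntegral.norm_integral_le_of_norm_le_const (a := (0 : ℝ)) (b := 1)
      (f := fun r => transl (r * h) (mulOp w u) - M (transl (r * h) u)) (C := K * |h| * ‖u‖)
      (fun r hr => by
        rw [uIoc_of_le zero_le_one] at hr
        rw [hM, transl_mulOp, ← mulOp_sub_left]
        refine (norm_mulOp_le (C := K * |h|) (fun x => ?_) _).trans (by simp)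
        rw [BoundedContinuousFunction.sub_apply, translB_apply]
        refine (hK _ _).trans ?_
        rw [add_sub_cancel_left, abs_mul, abs_of_pos hr.1]
        gcongr
        exact mul_le_of_le_one_left (abs_nonneg _) hr.2)
  simpa using this

/-! ### Test functions -/

/-- The type of test functions. -/
abbrev Test : Type := {φ : ℝ → ℂ // IsTestFunction φ}

namespace Test

lemma continuous (φ : Test) : Continuous φ.1 := φ.2.1.continuous

lemma memLp (φ : Test) : MemLp φ.1 2 volume := φ.continuous.memLp_of_hasCompactSupport φ.2.2

/-- A test function as an element of `L²`. -/
def toL2 (φ : Test) : L2R := φ.memLp.toLp _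

lemma coeFn_toL2 (φ : Test) : φ.toL2 =ᵐ[volume] φ.1 := φ.memLp.coeFn_toLp

lemma inner_toL2 (φ : Test) (u : L2R) : ⟪φ.toL2, u⟫_ℂ = ∫ x, u x * conj (φ.1 x) := by
  rw [L2R.inner_eq]
  apply integral_congr_ae
  filter_upwards [φ.coeFn_toL2] with x hx
  rw [hx]

/-- The complex conjugate of a test function. -/
def conjTest (φ : Test) : Test :=
  ⟨fun x => conj (φ.1 x), Complex.conjCLE.contDiff.comp φ.2.1,
    φ.2.2.comp_left (g := fun z : ℂ => conj z) (map_zero _)⟩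

lemma inner_conjTest (φ : Test) (u : L2R) : ⟪φ.conjTest.toL2, u⟫_ℂ = ∫ x, u x * φ.1 x := by
  rw [inner_toL2]
  simp [conjTest]

/-- The derivative of a test function. -/
def der (φ : Test) : Test :=
  ⟨deriv φ.1, (contDiff_infty_iff_deriv.1 φ.2.1).2, φ.2.2.deriv⟩

lemma hasDerivAt (φ : Test) (x : ℝ) : HasDerivAt φ.1 (φ.der.1 x) x :=
  ((contDiff_infty_iff_deriv.1 φ.2.1).1 x).hasDerivAt

lemma der_eq {φ χ : Test} (h : ∀ x, HasDerivAt φ.1 (χ.1 x) x) : φ.der = χ :=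
  Subtype.ext (funext fun x => (h x).deriv)

lemma conjTest_der (φ : Test) : φ.conjTest.der = φ.der.conjTest :=
  der_eq fun x => Complex.conjCLE.toContinuousLinearMap.hasFDerivAt.comp_hasDerivAt x
    (φ.hasDerivAt x)

lemma iterate_der (φ : Test) (k : ℕ) : (der^[k] φ).1 = iteratedDeriv k φ.1 := by
  induction k with
  | zero => simp
  | succ k ih => rw [Function.iterate_succ_apply', iteratedDeriv_succ, ← ih]; rfl

lemma conjTest_iterate_der (φ : Test) (k : ℕ) :
    der^[k] φ.conjTest = (der^[k] φ).conjTest := by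
  induction k with
  | zero => rfl
  | succ k ih => rw [Function.iterate_succ_apply', Function.iterate_succ_apply', ih, conjTest_der]

/-- The translate `φ(· + y)` of a test function. -/
def shift (y : ℝ) (φ : Test) : Test :=
  ⟨fun x => φ.1 (x + y), φ.2.1.comp (contDiff_id.add contDiff_const),
    φ.2.2.comp_homeomorph (Homeomorph.addRight y)⟩

lemma toL2_shift (y : ℝ) (φ : Test) : (φ.shift y).toL2 = transl y φ.toL2 := by
  apply Lp.ext
  filter_upwards [(φ.shift y).coeFn_toL2, coeFn_transl y φ.toL2,
    ae_comp_add_right φ.coeFn_toL2 y] with x h1 h2 h3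
  rw [h1, h2, h3]; rfl

lemma der_shift (y : ℝ) (φ : Test) : (φ.shift y).der = φ.der.shift y :=
  der_eq fun x => (φ.hasDerivAt (x + y)).comp_add_const x y

/-- The product of a test function and a smooth function. -/
def mulSmooth (m : ℝ → ℂ) (hm : ContDiff ℝ ∞ m) (φ : Test) : Test :=
  ⟨fun x => m x * φ.1 x, hm.mul φ.2.1, φ.2.2.mul_left⟩

/-- The test functions, as a subspace of `L²`. -/
def space : Submodule ℂ L2R where
  carrier := range toL2
  zero_mem' := ⟨⟨0, contDiff_const, HasCompactSupport.zero⟩, by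
    apply Lp.ext
    filter_upwards [coeFn_toL2 ⟨0, contDiff_const, HasCompactSupport.zero⟩,
      Lp.coeFn_zero ℂ 2 (volume : Measure ℝ)] with x h1 h2
    rw [h1, h2]⟩
  add_mem' := by
    rintro _ _ ⟨φ, rfl⟩ ⟨χ, rfl⟩
    refine ⟨⟨φ.1 + χ.1, φ.2.1.add χ.2.1, φ.2.2.add χ.2.2⟩, ?_⟩
    exact MemLp.toLp_add φ.memLp χ.memLp
  smul_mem' := by
    rintro c _ ⟨φ, rfl⟩
    refine ⟨⟨c • φ.1, φ.2.1.const_smul c, φ.2.2.smul_left (f := fun _ => c)⟩, ?_⟩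
    exact MemLp.toLp_const_smul c φ.memLp

lemma eq_zero_of_inner {u : L2R} (h : ∀ φ : Test, ⟪φ.toL2, u⟫_ℂ = 0) : u = 0 := by
  apply Lp.ext
  have := ae_eq_zero_of_integral_contDiff_smul_eq_zero
    ((Lp.memLp u).locallyIntegrable (by norm_num)) (fun g hg hg' => ?_)
  · filter_upwards [this, Lp.coeFn_zero ℂ 2 (volume : Measure ℝ)] with x h1 h2
    rw [h1, h2, Pi.zero_apply]
  · have := h ⟨fun x => (g x : ℂ), Complex.ofRealCLM.contDiff.comp hg,
      hg'.comp_left (g := fun z : ℝ => (z : ℂ)) Complex.ofReal_zero⟩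
    rw [inner_toL2] at this
    rw [← this]
    congr 1
    ext x
    simp [mul_comm]

lemma ext_inner {u v : L2R} (h : ∀ φ : Test, ⟪φ.toL2, u⟫_ℂ = ⟪φ.toL2, v⟫_ℂ) : u = v := by
  rw [← sub_eq_zero]
  exact eq_zero_of_inner fun φ => by rw [inner_sub_right, h, sub_self]

lemma denseRange_toL2 : DenseRange toL2 := by
  have : space.topologicalClosure = ⊤ := by
    rw [Submodule.topologicalClosure_eq_top_iff, Submodule.eq_bot_iff]
    intro u hu
    exact eq_zero_of_inner fun φ => (Submodule.mem_orthogonal _ _).1 hu _ ⟨φ, rfl⟩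
  exact (Submodule.dense_iff_topologicalClosure_eq_top (s := space)).2 this

lemma hasDerivAt_steklov (φ : Test) {h : ℝ} (hh : h ≠ 0) (x : ℝ) :
    HasDerivAt (fun x => ∫ r in (0 : ℝ)..1, φ.1 (x + r * h))
      ((h : ℂ)⁻¹ * (φ.1 (x + h) - φ.1 x)) x := by
  have e : (fun x => ∫ r in (0 : ℝ)..1, φ.1 (x + r * h))
      = fun x => (h : ℂ)⁻¹ * ((∫ y in (0 : ℝ)..(x + h), φ.1 y) - ∫ y in (0 : ℝ)..x, φ.1 y) := by
    ext x
    have := intervalIntegral.integral_comp_add_mul (a := 0) (b := 1) φ.1 hh x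
    simp only [mul_comm h] at this
    rw [this, zero_mul, add_zero, one_mul, Complex.real_smul, Complex.ofReal_inv,
      ← intervalIntegral.integral_add_adjacent_intervals (a := 0) (b := x) (c := x + h)
        (φ.continuous.intervalIntegrable _ _) (φ.continuous.intervalIntegrable _ _)]
    ring
  rw [e]
  have d : ∀ z, HasDerivAt (fun z => ∫ y in (0 : ℝ)..z, φ.1 y) (φ.1 z) z := fun z =>
    intervalIntegral.integral_hasDerivAt_right (φ.continuous.intervalIntegrable _ _)
      (φ.continuous.stronglyMeasurableAtFilter _ _) φ.continuous.continuousAt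
  exact (((d (x + h)).comp_add_const x h).sub (d x)).const_mul _

lemma steklov_contDiff (φ : Test) (h : ℝ) :
    ContDiff ℝ ∞ fun x => ∫ r in (0 : ℝ)..1, φ.1 (x + r * h) := by
  rcases eq_or_ne h 0 with rfl | hh
  · simpa using φ.2.1
  · refine contDiff_infty_iff_deriv.2
      ⟨fun x => (φ.hasDerivAt_steklov hh x).differentiableAt, ?_⟩
    rw [funext fun x => (φ.hasDerivAt_steklov hh x).deriv]
    exact contDiff_const.mul ((φ.2.1.comp (contDiff_id.add contDiff_const)).sub φ.2.1)

lemma steklov_hasCompactSupport (φ : Test) (h : ℝ) :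
    HasCompactSupport fun x => ∫ r in (0 : ℝ)..1, φ.1 (x + r * h) := by
  obtain ⟨R, hR⟩ := φ.2.2.isCompact.isBounded.subset_closedBall 0
  refine HasCompactSupport.intro (isCompact_closedBall (0 : ℝ) (R + |h|)) fun x hx => ?_
  rw [intervalIntegral.integral_congr (g := fun _ => (0 : ℂ)), intervalIntegral.integral_zero]
  intro r hr
  rw [uIcc_of_le zero_le_one] at hr
  refine image_eq_zero_of_notMem_tsupport fun hm => hx ?_
  have h1 := hR hm
  rw [mem_closedBall_zero_iff, Real.norm_eq_abs] at h1 ⊢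
  have h2 : |r * h| ≤ |h| := by
    rw [abs_mul, abs_of_nonneg hr.1]
    exact mul_le_of_le_one_left (abs_nonneg _) hr.2
  calc |x| = |(x + r * h) - r * h| := by ring_nf
    _ ≤ |x + r * h| + |r * h| := abs_sub _ _
    _ ≤ R + |h| := add_le_add h1 h2

/-- The Steklov average of a test function, the pointwise counterpart of `avg`. -/
def steklov (h : ℝ) (φ : Test) : Test :=
  ⟨fun x => ∫ r in (0 : ℝ)..1, φ.1 (x + r * h), φ.steklov_contDiff h,
    φ.steklov_hasCompactSupport h⟩

lemma toL2_steklov (h : ℝ) (φ : Test) : (φ.steklov h).toL2 = avg h φ.toL2 := by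
  refine ext_inner fun χ => ?_
  have h1 : ⟪χ.toL2, avg h φ.toL2⟫_ℂ = ∫ r in (0 : ℝ)..1, ⟪χ.toL2, transl (r * h) φ.toL2⟫_ℂ :=
    ((innerSL ℂ χ.toL2).intervalIntegral_comp_comm (intervalIntegrable_transl h _ 0 1)).symm
  have h2 : ∀ r : ℝ, ⟪χ.toL2, transl (r * h) φ.toL2⟫_ℂ
      = ∫ x, φ.1 (x + r * h) * conj (χ.1 x) := by
    intro r
    rw [← toL2_shift, inner_toL2]
    apply integral_congr_ae
    filter_upwards [(φ.shift (r * h)).coeFn_toL2] with x hx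
    rw [hx]; rfl
  have h3 : ⟪χ.toL2, (φ.steklov h).toL2⟫_ℂ
      = ∫ x, ∫ r in (0 : ℝ)..1, φ.1 (x + r * h) * conj (χ.1 x) := by
    rw [inner_toL2]
    apply integral_congr_ae
    filter_upwards [(φ.steklov h).coeFn_toL2] with x hx
    rw [hx, intervalIntegral.integral_mul_const]; rfl
  rw [h1, h3]
  simp only [h2, intervalIntegral.integral_of_le zero_le_one]
  rw [integral_integral_swap]
  obtain ⟨C, hC⟩ := φ.continuous.bounded_above_of_compact_support φ.2.2
  have hi : Integrable (fun p : ℝ × ℝ => ‖χ.1 p.1‖ * C)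
      ((volume : Measure ℝ).prod (volume.restrict (Ioc (0 : ℝ) 1))) :=
    (χ.continuous.integrable_of_hasCompactSupport χ.2.2).norm.mul_prod
      (integrable_const (α := ℝ) (μ := volume.restrict (Ioc (0 : ℝ) 1)) C)
  refine hi.mono' (Continuous.aestronglyMeasurable ?_) (Eventually.of_forall fun p => ?_)
  · exact (φ.continuous.comp (by fun_prop)).mul
      (Complex.continuous_conj.comp (χ.continuous.comp continuous_fst))
  · simp only [Function.uncurry, norm_mul, RCLike.norm_conj]
    rw [mul_comm]
    exact mul_le_mul_of_nonneg_left (hC _) (norm_nonneg _)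

lemma der_steklov (h : ℝ) (φ : Test) : (φ.steklov h).der = φ.der.steklov h := by
  rcases eq_or_ne h 0 with rfl | hh
  · have : ∀ χ : Test, χ.steklov 0 = χ := fun χ => Subtype.ext (by simp [steklov])
    rw [this, this]
  refine der_eq fun x => ?_
  refine (φ.hasDerivAt_steklov hh x).congr_deriv ?_
  have key : ∫ r in (0 : ℝ)..1, φ.der.1 (x + r * h)
      = h⁻¹ • ∫ y in (x + h * 0)..(x + h * 1), φ.der.1 y := by
    rw [← intervalIntegral.integral_comp_add_mul φ.der.1 hh x]
    simp only [mul_comm h]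
  change _ = ∫ r in (0 : ℝ)..1, φ.der.1 (x + r * h)
  rw [key, mul_zero, add_zero, mul_one, Complex.real_smul, Complex.ofReal_inv,
    intervalIntegral.integral_eq_sub_of_hasDerivAt (fun y _ => φ.hasDerivAt y)
      (φ.der.continuous.intervalIntegrable _ _)]

/-- The derivative of a Steklov average is a difference quotient. -/
lemma smul_toL2_der_steklov (h : ℝ) (φ : Test) :
    (h : ℂ) • (φ.steklov h).der.toL2 = transl h φ.toL2 - φ.toL2 := by
  rcases eq_or_ne h 0 with rfl | hh
  · simp [transl_zero]
  rw [← toL2_shift]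
  apply Lp.ext
  filter_upwards [Lp.coeFn_smul (h : ℂ) (φ.steklov h).der.toL2, (φ.steklov h).der.coeFn_toL2,
    Lp.coeFn_sub (φ.shift h).toL2 φ.toL2, φ.coeFn_toL2, (φ.shift h).coeFn_toL2]
    with x h1 h2 h3 h4 h5
  rw [h1, h3, Pi.smul_apply, h2, Pi.sub_apply, h4, h5, smul_eq_mul]
  have : (φ.steklov h).der.1 x = (h : ℂ)⁻¹ * (φ.1 (x + h) - φ.1 x) :=
    (φ.hasDerivAt_steklov hh x).deriv
  rw [this, mul_inv_cancel_left₀ (Complex.ofReal_ne_zero.2 hh)]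
  rfl

end Test

/-! ### The energy inequality for weak solutions -/

/-- If the inner products of `v` with a dense set of vectors `φ` are differentiable with
derivative `⟪φ, g⟫` and `g` is bounded, then `‖v‖²` is differentiable. No continuity or
measurability of `g` is needed: boundedness makes `v` Lipschitz, so that its difference quotients
converge weakly. -/
lemma hasDerivWithinAt_norm_sq_of_weak {H : Type*} [NormedAddCommGroup H]
    [InnerProductSpace ℂ H] {T K : ℝ} {v g : ℝ → H} {S : Set H} (hS : Dense S)
    (hK : ∀ t ∈ Icc 0 T, ‖g t‖ ≤ K)
    (h : ∀ φ ∈ S, ∀ t ∈ Icc 0 T,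
      HasDerivWithinAt (fun s => ⟪φ, v s⟫_ℂ) ⟪φ, g t⟫_ℂ (Icc 0 T) t)
    {t : ℝ} (ht : t ∈ Icc 0 T) :
    HasDerivWithinAt (fun s => ‖v s‖ ^ 2) (2 * (⟪v t, g t⟫_ℂ).re) (Icc 0 T) t := by
  have hK0 : 0 ≤ K := (norm_nonneg _).trans (hK t ht)
  have lip : ∀ s ∈ Icc 0 T, ‖v s - v t‖ ≤ K * |s - t| := by
    intro s hs
    have key : ∀ φ : H, ‖⟪φ, v s - v t⟫_ℂ‖ ≤ K * |s - t| * ‖φ‖ := by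
      intro φ
      refine hS.induction (P := fun φ => ‖⟪φ, v s - v t⟫_ℂ‖ ≤ K * |s - t| * ‖φ‖) ?_
        (isClosed_le (by fun_prop) (by fun_prop)) φ
      intro φ hφ
      have := (convex_Icc 0 T).norm_image_sub_le_of_norm_hasDerivWithin_le (h φ hφ)
        (C := ‖φ‖ * K) (fun x hx => (norm_inner_le_norm _ _).trans (by gcongr; exact hK x hx))
        ht hs
      rw [inner_sub_right]
      refine this.trans (le_of_eq ?_)
      rw [Real.norm_eq_abs]; ring
    have h1 := key (v s - v t)
    rw [inner_self_eq_norm_sq_to_K, norm_pow, RCLike.norm_ofReal, abs_norm, pow_two] at h1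
    rcases (norm_nonneg (v s - v t)).eq_or_lt with h0 | h0
    · rw [← h0]; positivity
    · exact le_of_mul_le_mul_right h1 h0
  have weak : ∀ c > 0, ∀ᶠ s in 𝓝[Icc 0 T] t,
      ‖⟪v t, v s - v t - (s - t) • g t⟫_ℂ‖ ≤ c * |s - t| := by
    intro c hc
    obtain ⟨φ, hφS, hφ⟩ := Metric.dense_iff.1 hS (v t) (c / (2 * (2 * K + 1))) (by positivity)
    rw [Metric.mem_ball, dist_comm, dist_eq_norm] at hφS
    have h1 := (hasDerivWithinAt_iff_isLittleO.1 (h φ hφ t ht)).def (half_pos hc)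
    filter_upwards [h1, self_mem_nhdsWithin] with s hs hsT
    have e : ⟪v t, v s - v t - (s - t) • g t⟫_ℂ
        = ⟪v t - φ, v s - v t - (s - t) • g t⟫_ℂ
          + (⟪φ, v s⟫_ℂ - ⟪φ, v t⟫_ℂ - (s - t) • ⟪φ, g t⟫_ℂ) := by
      rw [inner_sub_left (v t) φ, inner_sub_right φ, inner_sub_right φ, inner_smul_right_eq_smul]
      ring
    rw [e]
    have h2 : ‖v s - v t - (s - t) • g t‖ ≤ (2 * K) * |s - t| := by
      refine (norm_sub_le _ _).trans ?_
      rw [norm_smul, Real.norm_eq_abs]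
      nlinarith [lip s hsT, hK t ht, abs_nonneg (s - t)]
    refine (norm_add_le _ _).trans ?_
    have h3 : ‖⟪v t - φ, v s - v t - (s - t) • g t⟫_ℂ‖ ≤ c / 2 * |s - t| := by
      refine (norm_inner_le_norm _ _).trans ?_
      refine (mul_le_mul hφS.le h2 (norm_nonneg _) (by positivity)).trans ?_
      rw [← mul_assoc]
      refine mul_le_mul_of_nonneg_right ?_ (abs_nonneg _)
      rw [div_mul_eq_mul_div, div_le_iff₀ (by positivity)]
      nlinarith
    rw [Real.norm_eq_abs] at hs
    linarith
  rw [hasDerivWithinAt_iff_isLittleO, Asymptotics.isLittleO_iff]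
  intro c hc
  have small : ∀ᶠ s in 𝓝[Icc 0 T] t, |s - t| * K ^ 2 ≤ c / 2 := by
    have : Tendsto (fun s => |s - t| * K ^ 2) (𝓝[Icc 0 T] t) (𝓝 (|t - t| * K ^ 2)) :=
      (Continuous.tendsto (by fun_prop) t).mono_left nhdsWithin_le_nhds
    rw [sub_self, abs_zero, zero_mul] at this
    exact this.eventually_le_const (half_pos hc)
  filter_upwards [weak (c / 4) (by positivity), small, self_mem_nhdsWithin] with s h1 h2 hs
  have e : ‖v s‖ ^ 2 - ‖v t‖ ^ 2 - (s - t) • (2 * (⟪v t, g t⟫_ℂ).re)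
      = 2 * (⟪v t, v s - v t - (s - t) • g t⟫_ℂ).re + ‖v s - v t‖ ^ 2 := by
    have h3 : ‖v s‖ ^ 2 = ‖v t + (v s - v t)‖ ^ 2 := by rw [add_sub_cancel]
    rw [h3, @norm_add_sq ℂ, inner_sub_right _ (v s - v t), inner_smul_right_eq_smul]
    simp only [Complex.sub_re, Complex.real_smul, RCLike.re_to_complex, Complex.mul_re,
      Complex.ofReal_re, Complex.ofReal_im, smul_eq_mul]
    ring
  rw [e, Real.norm_eq_abs, Real.norm_eq_abs]
  refine (abs_add_le _ _).trans ?_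
  have h4 := (Complex.abs_re_le_norm _).trans h1
  have h5 : ‖v s - v t‖ ^ 2 ≤ c / 2 * |s - t| := by
    have := pow_le_pow_left₀ (norm_nonneg _) (lip s hs) 2
    nlinarith [abs_nonneg (s - t)]
  rw [abs_mul, abs_two, abs_of_nonneg (sq_nonneg ‖v s - v t‖)]
  linarith

lemma norm_le_add_of_hasDerivWithinAt_norm_sq {H : Type*} [NormedAddCommGroup H]
    {T c : ℝ} {v : ℝ → H} {d : ℝ → ℝ} (hc : 0 ≤ c)
    (h : ∀ t ∈ Icc 0 T, HasDerivWithinAt (fun s => ‖v s‖ ^ 2) (d t) (Icc 0 T) t)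
    (hd : ∀ t ∈ Icc 0 T, |d t| ≤ 2 * c * ‖v t‖) {t : ℝ} (ht : t ∈ Icc 0 T) :
    ‖v t‖ ≤ ‖v 0‖ + c * t := by
  refine le_of_forall_pos_le_add fun e he => ?_
  -- the square root is regularized, as `‖v‖` may vanish
  have pos : ∀ s, 0 < ‖v s‖ ^ 2 + e ^ 2 := fun s => by positivity
  have hder : ∀ s ∈ Icc 0 T, HasDerivWithinAt (fun s => Real.sqrt (‖v s‖ ^ 2 + e ^ 2))
      (d s / (2 * Real.sqrt (‖v s‖ ^ 2 + e ^ 2))) (Icc 0 T) s := fun s hs =>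
    ((h s hs).add_const (e ^ 2)).sqrt (pos s).ne'
  have bound : ∀ s ∈ Icc 0 T, ‖d s / (2 * Real.sqrt (‖v s‖ ^ 2 + e ^ 2))‖ ≤ c := by
    intro s hs
    have h1 : ‖v s‖ ≤ Real.sqrt (‖v s‖ ^ 2 + e ^ 2) :=
      Real.le_sqrt_of_sq_le (by nlinarith [sq_nonneg e])
    have h2 := Real.sqrt_pos.2 (pos s)
    rw [Real.norm_eq_abs, abs_div, abs_of_pos (by positivity : 0 < 2 * √(‖v s‖ ^ 2 + e ^ 2)),
      div_le_iff₀ (by positivity)]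
    nlinarith [hd s hs]
  have := (convex_Icc 0 T).norm_image_sub_le_of_norm_hasDerivWithin_le hder bound
    ⟨le_rfl, ht.1.trans ht.2⟩ ht
  rw [Real.norm_eq_abs, Real.norm_eq_abs, sub_zero, abs_of_nonneg ht.1] at this
  have h1 : ‖v t‖ ≤ Real.sqrt (‖v t‖ ^ 2 + e ^ 2) :=
    Real.le_sqrt_of_sq_le (by nlinarith [sq_nonneg e])
  have h2 : Real.sqrt (‖v 0‖ ^ 2 + e ^ 2) ≤ ‖v 0‖ + e := by
    rw [Real.sqrt_le_left (by positivity)]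
    nlinarith [norm_nonneg (v 0)]
  linarith [le_abs_self (√(‖v t‖ ^ 2 + e ^ 2) - √(‖v 0‖ ^ 2 + e ^ 2))]

/-- `u` is a weak solution on `[0, T]` of `iħ ∂ₜu = -(ħ²/2) ∂ₓ²u + f`. The test function enters
through its complex conjugate, by way of the inner product of `L²`. -/
def IsWeakSol (ħ T : ℝ) (u f : ℝ → L2R) : Prop :=
  ∀ φ : Test, ∀ t ∈ Icc 0 T,
    HasDerivWithinAt (fun s => ⟪φ.toL2, u s⟫_ℂ)
      ((Complex.I * ħ)⁻¹ * (-(1 / 2) * (ħ : ℂ) ^ 2 * ⟪φ.der.der.toL2, u t⟫_ℂ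
        + ⟪φ.toL2, f t⟫_ℂ)) (Icc 0 T) t

/-- The second difference `u(· + d) + u(· - d) - 2u`. -/
def secondDiff (d : ℝ) (u : L2R) : L2R := transl d u + transl (-d) u - (2 : ℂ) • u

lemma norm_secondDiff_le (d : ℝ) (u : L2R) : ‖secondDiff d u‖ ≤ 4 * ‖u‖ := by
  have h1 := norm_add_le (transl d u) (transl (-d) u)
  have h2 := norm_sub_le (transl d u + transl (-d) u) ((2 : ℂ) • u)
  rw [norm_smul, Complex.norm_ofNat] at h2
  rw [(transl d).norm_map, (transl (-d)).norm_map] at h1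
  rw [secondDiff]
  linarith

lemma inner_secondDiff (d : ℝ) (u v : L2R) :
    ⟪u, secondDiff d v⟫_ℂ = ⟪secondDiff d u, v⟫_ℂ := by
  simp only [secondDiff, inner_sub_left, inner_sub_right, inner_add_left, inner_add_right,
    inner_transl, inner_smul_left, inner_smul_right, neg_neg, map_ofNat]
  ring

lemma avg_secondDiff (h d : ℝ) (u : L2R) : avg h (secondDiff d u) = secondDiff d (avg h u) := by
  simp only [secondDiff, map_sub, map_add, map_smul, avg_transl]

/-- The energy identity at the level of regularized functions: the kinetic term is real. -/
lemma inner_avg_avg_secondDiff_im (d : ℝ) (u : L2R) :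
    (⟪avg d (avg (-d) u), secondDiff d u⟫_ℂ).im = 0 := by
  have h1 : ⟪avg d (avg (-d) u), secondDiff d u⟫_ℂ
      = ⟪avg (-d) u, secondDiff d (avg (-d) u)⟫_ℂ := by
    rw [← avg_secondDiff, inner_avg, neg_neg]
  rw [h1, ← Complex.conj_eq_iff_im, inner_conj_symm, inner_secondDiff]

lemma inner_mulOp_self_im {w : ℝ →ᵇ ℂ} (hw : ∀ x, conj (w x) = w x) (u : L2R) :
    (⟪u, mulOp w u⟫_ℂ).im = 0 := by
  rw [← Complex.conj_eq_iff_im, inner_conj_symm, inner_mulOp (fun x => (hw x).symm)]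

lemma Test.toL2_der_der_steklov {d : ℝ} (hd : d ≠ 0) (φ : Test) :
    ((φ.steklov (-d)).steklov d).der.der.toL2 = ((d : ℂ) ^ 2)⁻¹ • secondDiff d φ.toL2 := by
  have h1 := Test.smul_toL2_der_steklov d (φ.steklov (-d)).der
  have h2 := Test.smul_toL2_der_steklov (-d) φ
  have hd' : (d : ℂ) ≠ 0 := Complex.ofReal_ne_zero.2 hd
  rw [← Test.der_steklov] at h1
  have h3 : ((d : ℂ) ^ 2) • ((φ.steklov (-d)).steklov d).der.der.toL2 = secondDiff d φ.toL2 := by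
    have h4 : (d : ℂ) • (φ.steklov (-d)).der.toL2 = φ.toL2 - transl (-d) φ.toL2 := by
      rw [← neg_sub, ← h2, Complex.ofReal_neg, neg_smul, neg_neg]
    rw [pow_two, mul_smul, h1, smul_sub, ← map_smul, h4, map_sub, transl_transl, add_neg_cancel,
      transl_zero, secondDiff, two_smul]
    abel
  rw [← h3, inv_smul_smul₀ (pow_ne_zero 2 hd')]

lemma norm_avg_avg_mulOp_sub_le {w : ℝ →ᵇ ℂ} {L : ℝ} (hL : ∀ x y, ‖w x - w y‖ ≤ L * |x - y|)
    (d : ℝ) (u : L2R) :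
    ‖avg d (avg (-d) (mulOp w u)) - mulOp w (avg d (avg (-d) u))‖ ≤ 2 * (L * |d|) * ‖u‖ := by
  have hL0 : 0 ≤ L := by
    have := (norm_nonneg _).trans (hL 1 0); simpa using this
  have h1 := norm_avg_mulOp_sub_le hL (-d) u
  have h2 := norm_avg_mulOp_sub_le hL d (avg (-d) u)
  have h3 := norm_avg_le d (avg (-d) (mulOp w u) - mulOp w (avg (-d) u))
  have h4 : L * |d| * ‖avg (-d) u‖ ≤ L * |d| * ‖u‖ := by
    gcongr; exact norm_avg_le _ _
  rw [abs_neg] at h1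
  have e : avg d (avg (-d) (mulOp w u)) - mulOp w (avg d (avg (-d) u))
      = avg d (avg (-d) (mulOp w u) - mulOp w (avg (-d) u))
        + (avg d (mulOp w (avg (-d) u)) - mulOp w (avg d (avg (-d) u))) := by
    rw [map_sub]; abel
  rw [e]
  linarith [norm_add_le (avg d (avg (-d) (mulOp w u) - mulOp w (avg (-d) u)))
    (avg d (mulOp w (avg (-d) u)) - mulOp w (avg d (avg (-d) u)))]

/-- The energy inequality: a weak solution of `iħ ∂ₜu = -(ħ²/2) ∂ₓ²u + W u + F`, with `W` real and
Lipschitz in `x`, grows in norm at most at the rate `‖F‖ / ħ`. -/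
theorem IsWeakSol.norm_le {ħ T K B L M : ℝ} (hħ : 0 < ħ) {u f : ℝ → L2R} {W : ℝ → ℝ →ᵇ ℂ}
    (h : IsWeakSol ħ T u f)
    (hW : ∀ t ∈ Icc 0 T, ∀ x, conj (W t x) = W t x)
    (hB : ∀ t ∈ Icc 0 T, ∀ x, ‖W t x‖ ≤ B)
    (hL : ∀ t ∈ Icc 0 T, ∀ x y, ‖W t x - W t y‖ ≤ L * |x - y|)
    (hK : ∀ t ∈ Icc 0 T, ‖u t‖ ≤ K)
    (hM : ∀ t ∈ Icc 0 T, ‖f t - mulOp (W t) (u t)‖ ≤ M) {t : ℝ} (ht : t ∈ Icc 0 T) :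
    ‖u t‖ ≤ ‖u 0‖ + t * (M / ħ) := by
  have hK0 : 0 ≤ K := (norm_nonneg _).trans (hK t ht)
  have hM0 : 0 ≤ M := (norm_nonneg _).trans (hM t ht)
  have hB0 : 0 ≤ B := (norm_nonneg _).trans (hB t ht 0)
  have hL0 : 0 ≤ L := by
    have := (norm_nonneg _).trans (hL t ht 1 0); simpa using this
  have hħ' : (ħ : ℂ) ≠ 0 := Complex.ofReal_ne_zero.2 hħ.ne'
  have main : ∀ d : ℝ, 0 < d →
      ‖avg d (avg (-d) (u t))‖ ≤ ‖u 0‖ + (M + 2 * (L * d) * K) / ħ * t := by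
    intro d hd
    -- `v` is the regularized solution and `g` its time derivative, bounded for fixed `d` only
    let c : ℝ := -(1 / 2) * ħ ^ 2 * (d ^ 2)⁻¹
    let v : ℝ → L2R := fun t => avg d (avg (-d) (u t))
    let g : ℝ → L2R := fun t => (Complex.I * ħ)⁻¹ •
      ((c : ℂ) • secondDiff d (u t) + avg d (avg (-d) (f t)))
    have hf : ∀ s ∈ Icc 0 T, ‖f s‖ ≤ M + B * K := by
      intro s hs
      have h1 := norm_add_le (f s - mulOp (W s) (u s)) (mulOp (W s) (u s))
      rw [sub_add_cancel] at h1
      have h2 := norm_mulOp_le (hB s hs) (u s)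
      have h3 : B * ‖u s‖ ≤ B * K := by gcongr; exact hK s hs
      linarith [hM s hs]
    have hg : ∀ s ∈ Icc 0 T, ‖g s‖ ≤ ħ⁻¹ * (|c| * (4 * K) + (M + B * K)) := by
      intro s hs
      simp only [g, norm_smul, norm_inv, norm_mul, Complex.norm_I, one_mul, Complex.norm_real,
        Real.norm_eq_abs, abs_of_pos hħ]
      gcongr
      refine (norm_add_le _ _).trans ?_
      rw [norm_smul, Complex.norm_real, Real.norm_eq_abs]
      gcongr
      · exact (norm_secondDiff_le _ _).trans (by gcongr; exact hK s hs)
      · exact ((norm_avg_le _ _).trans (norm_avg_le _ _)).trans (hf s hs)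
    have hv : ∀ φ ∈ range Test.toL2, ∀ s ∈ Icc 0 T,
        HasDerivWithinAt (fun r => ⟪φ, v r⟫_ℂ) ⟪φ, g s⟫_ℂ (Icc 0 T) s := by
      rintro _ ⟨φ, rfl⟩ s hs
      have e : ∀ w : L2R, ⟪φ.toL2, avg d (avg (-d) w)⟫_ℂ
          = ⟪((φ.steklov (-d)).steklov d).toL2, w⟫_ℂ := fun w => by
        rw [inner_avg, inner_avg, neg_neg, Test.toL2_steklov, Test.toL2_steklov]
      have h1 := h ((φ.steklov (-d)).steklov d) s hs
      simp only [v, e]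
      refine h1.congr_deriv ?_
      rw [Test.toL2_der_der_steklov hd.ne', ← e]
      simp only [g, inner_smul_right, inner_add_right, inner_smul_left, map_inv₀, map_pow,
        Complex.conj_ofReal, inner_secondDiff]
      simp only [c]
      push_cast
      ring
    have hder := fun s hs => hasDerivWithinAt_norm_sq_of_weak (t := s) Test.denseRange_toL2 hg hv hs
    have hdb : ∀ s ∈ Icc 0 T,
        |2 * (⟪v s, g s⟫_ℂ).re| ≤ 2 * ((M + 2 * (L * d) * K) / ħ) * ‖v s‖ := by
      intro s hs
      -- only the source and the commutator of the average with `W` contribute to the growth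
      let F := f s - mulOp (W s) (u s)
      let R := avg d (avg (-d) F)
        + (avg d (avg (-d) (mulOp (W s) (u s))) - mulOp (W s) (avg d (avg (-d) (u s))))
      have hR : ‖R‖ ≤ M + 2 * (L * d) * K := by
        refine (norm_add_le _ _).trans (add_le_add ?_ ?_)
        · exact ((norm_avg_le _ _).trans (norm_avg_le _ _)).trans (hM s hs)
        · refine (norm_avg_avg_mulOp_sub_le (hL s hs) d (u s)).trans ?_
          rw [abs_of_pos hd]
          gcongr
          exact hK s hs
      have e : g s = (Complex.I * ħ)⁻¹ • ((c : ℂ) • secondDiff d (u s)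
          + mulOp (W s) (v s) + R) := by
        simp only [g, R, F, v, map_sub]
        congr 1
        abel
      have h1 : (⟪v s, g s⟫_ℂ).re = ħ⁻¹ * (⟪v s, R⟫_ℂ).im := by
        rw [e, inner_smul_right, inner_add_right, inner_add_right, inner_smul_right]
        have h2 := inner_avg_avg_secondDiff_im d (u s)
        have h3 := inner_mulOp_self_im (hW s hs) (v s)
        have h4 : (Complex.I * (ħ : ℂ))⁻¹ = -((ħ⁻¹ : ℝ) * Complex.I) := by
          rw [mul_inv, Complex.inv_I]; push_cast; ring
        rw [h4]
        simp only [v] at h2 h3 ⊢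
        simp [h2, h3]
      rw [h1, abs_mul, abs_mul, abs_two, abs_of_pos (inv_pos.2 hħ)]
      have h5 : |(⟪v s, R⟫_ℂ).im| ≤ ‖v s‖ * (M + 2 * (L * d) * K) :=
        (Complex.abs_im_le_norm _).trans ((norm_inner_le_norm _ _).trans (by gcongr))
      calc 2 * (ħ⁻¹ * |(⟪v s, R⟫_ℂ).im|) ≤ 2 * (ħ⁻¹ * (‖v s‖ * (M + 2 * (L * d) * K))) := by gcongr
        _ = _ := by ring
    have := norm_le_add_of_hasDerivWithinAt_norm_sq (by positivity) hder hdb ht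
    have h0 : ‖v 0‖ ≤ ‖u 0‖ := (norm_avg_le _ _).trans (norm_avg_le _ _)
    simp only [v] at this h0
    linarith
  have lim1 : Tendsto (fun d : ℝ => ‖avg d (avg (-d) (u t))‖) (𝓝[>] 0) (𝓝 ‖u t‖) := by
    have h1 : Tendsto (fun d : ℝ => avg (-d) (u t)) (𝓝[>] 0) (𝓝 (u t)) := by
      have : Tendsto (fun d : ℝ => -d) (𝓝[>] 0) (𝓝 0) := by
        simpa using (continuous_neg.tendsto (0 : ℝ)).mono_left nhdsWithin_le_nhds
      exact (tendsto_avg (u t)).comp this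
    have h2 := (tendsto_avg (u t)).mono_left (nhdsWithin_le_nhds (s := Ioi 0))
    refine Tendsto.norm ?_
    have h3 : Tendsto (fun d : ℝ => avg d (avg (-d) (u t) - u t)) (𝓝[>] 0) (𝓝 0) :=
      squeeze_zero_norm (fun d => norm_avg_le d _) (by
        simpa using (h1.sub_const (u t)).norm)
    simpa using h3.add h2
  have lim2 : Tendsto (fun d : ℝ => ‖u 0‖ + (M + 2 * (L * d) * K) / ħ * t) (𝓝[>] 0)
      (𝓝 (‖u 0‖ + (M + 2 * (L * 0) * K) / ħ * t)) :=
    (Continuous.tendsto (by fun_prop) 0).mono_left nhdsWithin_le_nhds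
  have := le_of_tendsto_of_tendsto lim1 lim2 (by
    filter_upwards [self_mem_nhdsWithin] with d hd using main d hd)
  refine this.trans (le_of_eq ?_)
  ring

/-! ### Semiclassical difference quotients and their Leibniz rules -/

/-- The semiclassical difference quotient `u ↦ ħ (u(· + h) - u) / h`, a stand-in for `ħ ∂ₓ`. -/
def dq (ħ h : ℝ) : L2R →ₗ[ℂ] L2R :=
  ((ħ / h : ℝ) : ℂ) • ((transl h).toLinearMap - LinearMap.id)

lemma dq_apply (ħ h : ℝ) (u : L2R) : dq ħ h u = ((ħ / h : ℝ) : ℂ) • (transl h u - u) := rfl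

/-- The semiclassical difference quotient of a bounded continuous function. -/
def dqB (ħ h : ℝ) : (ℝ →ᵇ ℂ) →+ (ℝ →ᵇ ℂ) where
  toFun w := ((ħ / h : ℝ) : ℂ) • (translB h w - w)
  map_zero' := by ext x; simp [translB_apply]
  map_add' w z := by ext x; simp [translB_apply]; ring

lemma dqB_apply (ħ h : ℝ) (w : ℝ →ᵇ ℂ) :
    dqB ħ h w = ((ħ / h : ℝ) : ℂ) • (translB h w - w) := rfl

lemma dq_transl (ħ h y : ℝ) (u : L2R) : dq ħ h (transl y u) = transl y (dq ħ h u) := by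
  simp only [dq_apply, map_smul, map_sub, transl_comm]

lemma iterate_dq_transl (ħ h y : ℝ) (k : ℕ) (u : L2R) :
    (dq ħ h)^[k] (transl y u) = transl y ((dq ħ h)^[k] u) := by
  induction k generalizing u with
  | zero => rfl
  | succ k ih => rw [Function.iterate_succ_apply, Function.iterate_succ_apply, dq_transl, ih]

lemma norm_iterate_dq_le {ħ h : ℝ} (k : ℕ) (u : L2R) :
    ‖(dq ħ h)^[k] u‖ ≤ (2 * |ħ / h|) ^ k * ‖u‖ := by
  induction k with
  | zero => simp
  | succ k ih =>
    rw [Function.iterate_succ_apply', dq_apply, norm_smul, Complex.norm_real, Real.norm_eq_abs]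
    have := norm_sub_le (transl h ((dq ħ h)^[k] u)) ((dq ħ h)^[k] u)
    rw [(transl h).norm_map] at this
    calc |ħ / h| * ‖transl h ((dq ħ h)^[k] u) - (dq ħ h)^[k] u‖
        ≤ |ħ / h| * (2 * ((2 * |ħ / h|) ^ k * ‖u‖)) := by gcongr; linarith
      _ = _ := by ring

/-- Leibniz rule for difference quotients. -/
lemma dq_mulOp (ħ h : ℝ) (w : ℝ →ᵇ ℂ) (u : L2R) :
    dq ħ h (mulOp w u) = mulOp w (dq ħ h u) + mulOp (dqB ħ h w) (transl h u) := by
  rw [dq_apply, dq_apply, dqB_apply, mulOp_smul_left, mulOp_sub_left, transl_mulOp, map_smul,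
    map_sub, ← smul_add]
  congr 1
  abel

lemma norm_iterate_dq_mulOp_le {ħ h a b : ℝ} (k : ℕ) {w : ℝ →ᵇ ℂ} {u : L2R}
    (hw : ∀ j ≤ k, ∀ x, ‖(dqB ħ h)^[j] w x‖ ≤ b) (hu : ∀ j ≤ k, ‖(dq ħ h)^[j] u‖ ≤ a) :
    ‖(dq ħ h)^[k] (mulOp w u)‖ ≤ 2 ^ k * (b * a) := by
  have hb : 0 ≤ b := (norm_nonneg _).trans (hw 0 (Nat.zero_le _) 0)
  induction k generalizing w u with
  | zero =>
    have h1 : ‖u‖ ≤ a := hu 0 le_rfl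
    rw [pow_zero, one_mul]
    refine (norm_mulOp_le (hw 0 le_rfl) u).trans (by gcongr)
  | succ k ih =>
    rw [Function.iterate_succ_apply, dq_mulOp, iterate_map_add]
    have h1 := ih (w := w) (u := dq ħ h u) (fun j hj => hw j (by omega)) (fun j hj => by
      rw [← Function.iterate_succ_apply]; exact hu _ (by omega))
    have h2 := ih (w := dqB ħ h w) (u := transl h u) (fun j hj x => by
      rw [← Function.iterate_succ_apply]; exact hw _ (by omega) x) (fun j hj => by
      rw [iterate_dq_transl, LinearIsometry.norm_map]; exact hu _ (by omega))
    refine (norm_add_le _ _).trans ((add_le_add h1 h2).trans (le_of_eq ?_))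
    ring

/-- The commutator of iterated difference quotients with a multiplication involves the
difference quotients of the multiplier of positive order only. -/
lemma norm_iterate_dq_mulOp_sub_le {ħ h a b : ℝ} (hb : 0 ≤ b) (k : ℕ) {w : ℝ →ᵇ ℂ}
    {u : L2R} (hw : ∀ j, 1 ≤ j → j ≤ k → ∀ x, ‖(dqB ħ h)^[j] w x‖ ≤ b)
    (ha : 0 ≤ a) (hu : ∀ j < k, ‖(dq ħ h)^[j] u‖ ≤ a) :
    ‖(dq ħ h)^[k] (mulOp w u) - mulOp w ((dq ħ h)^[k] u)‖ ≤ 2 ^ k * (b * a) := by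
  induction k generalizing w u with
  | zero => simp; positivity
  | succ k ih =>
    rw [Function.iterate_succ_apply, Function.iterate_succ_apply, dq_mulOp, iterate_map_add,
      add_sub_right_comm]
    have h1 := ih (w := w) (u := dq ħ h u) (fun j hj hj' => hw j hj (by omega)) (fun j hj => by
      rw [← Function.iterate_succ_apply]; exact hu _ (by omega))
    have h2 := norm_iterate_dq_mulOp_le k (ħ := ħ) (h := h) (a := a) (b := b) (w := dqB ħ h w)
      (u := transl h u) (fun j hj x => by
        rw [← Function.iterate_succ_apply]; exact hw _ (by omega) (by omega) x) (fun j hj => by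
        rw [iterate_dq_transl, LinearIsometry.norm_map]; exact hu _ (by omega))
    refine (norm_add_le _ _).trans ((add_le_add h1 h2).trans (le_of_eq ?_))
    ring

lemma IsWeakSol.dq {ħ T : ℝ} {u f : ℝ → L2R} (H : IsWeakSol ħ T u f) (h : ℝ) :
    IsWeakSol ħ T (fun t => dq ħ h (u t)) (fun t => dq ħ h (f t)) := by
  intro φ t ht
  have h1 := H (φ.shift (-h)) t ht
  have h2 := H φ t ht
  have e : ∀ (χ : Test) (w : L2R), ⟪χ.toL2, _root_.dq ħ h w⟫_ℂ
      = ((ħ / h : ℝ) : ℂ) * (⟪(χ.shift (-h)).toL2, w⟫_ℂ - ⟪χ.toL2, w⟫_ℂ) := by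
    intro χ w
    rw [dq_apply, inner_smul_right, inner_sub_right, inner_transl, Test.toL2_shift]
  simp only [e]
  refine ((h1.sub h2).const_mul _).congr_deriv ?_
  rw [Test.der_shift, Test.der_shift]
  ring

lemma IsWeakSol.iterate_dq {ħ T : ℝ} {u f : ℝ → L2R} (H : IsWeakSol ħ T u f) (h : ℝ) (k : ℕ) :
    IsWeakSol ħ T (fun t => (_root_.dq ħ h)^[k] (u t)) (fun t => (_root_.dq ħ h)^[k] (f t)) := by
  induction k with
  | zero => exact H
  | succ k ih => simpa only [Function.iterate_succ_apply'] using ih.dq h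

/-! ### The Hartree potential -/

/-- The function `V(x - ·)`. -/
def reflB (V : ℝ →ᵇ ℂ) (x : ℝ) : ℝ →ᵇ ℂ := V.compContinuous ⟨fun y => x - y, by fun_prop⟩

lemma reflB_apply (V : ℝ →ᵇ ℂ) (x y : ℝ) : reflB V x y = V (x - y) := rfl

lemma inner_mulOp_reflB (V : ℝ →ᵇ ℂ) (u v : L2R) (x : ℝ) :
    ⟪u, mulOp (reflB V x) v⟫_ℂ = ∫ y, V (x - y) * (v y * conj (u y)) := by
  rw [L2R.inner_eq]
  apply integral_congr_ae
  filter_upwards [coeFn_mulOp (reflB V x) v] with y hy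
  rw [hy, reflB_apply, mul_assoc]

/-- The potential `V * (v ū)`, sesquilinear in `u` and `v`. -/
def potential (V : ℝ →ᵇ ℂ) (u v : L2R) : ℝ →ᵇ ℂ :=
  BoundedContinuousFunction.ofNormedAddCommGroup (fun x => ⟪u, mulOp (reflB V x) v⟫_ℂ)
    (by
      simp only [inner_mulOp_reflB]
      have hi : Integrable (fun y => v y * conj (u y)) volume := L2.integrable_inner (𝕜 := ℂ) u v
      refine continuous_of_dominated (bound := fun y => ‖V‖ * ‖v y * conj (u y)‖)
        (fun x => ((V.continuous.comp (by fun_prop)).aestronglyMeasurable).mul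
          hi.aestronglyMeasurable) (fun x => Eventually.of_forall fun y => ?_)
        (hi.norm.const_mul _) (Eventually.of_forall fun y => ?_)
      · rw [norm_mul]
        exact mul_le_mul_of_nonneg_right (V.norm_coe_le_norm _) (norm_nonneg _)
      · exact (V.continuous.comp (by fun_prop)).mul continuous_const)
    (‖u‖ * (‖V‖ * ‖v‖)) (fun x => (norm_inner_le_norm _ _).trans (by
      gcongr
      exact norm_mulOp_le (w := reflB V x) (fun y => V.norm_coe_le_norm _) v))

lemma potential_apply (V : ℝ →ᵇ ℂ) (u v : L2R) (x : ℝ) :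
    potential V u v x = ⟪u, mulOp (reflB V x) v⟫_ℂ := rfl

lemma norm_potential_le (V : ℝ →ᵇ ℂ) (u v : L2R) (x : ℝ) :
    ‖potential V u v x‖ ≤ ‖V‖ * (‖u‖ * ‖v‖) := by
  rw [potential_apply]
  refine (norm_inner_le_norm _ _).trans ?_
  have := norm_mulOp_le (w := reflB V x) (fun y => V.norm_coe_le_norm _) v
  calc ‖u‖ * ‖mulOp (reflB V x) v‖ ≤ ‖u‖ * (‖V‖ * ‖v‖) := by gcongr
    _ = _ := by ring

lemma norm_potential_sub_le {V : ℝ →ᵇ ℂ} {l : ℝ} (hV : ∀ a b, ‖V a - V b‖ ≤ l * |a - b|)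
    (u v : L2R) (x y : ℝ) :
    ‖potential V u v x - potential V u v y‖ ≤ l * (‖u‖ * ‖v‖) * |x - y| := by
  rw [potential_apply, potential_apply, ← inner_sub_right, ← mulOp_sub_left]
  refine (norm_inner_le_norm _ _).trans ?_
  have := norm_mulOp_le (w := reflB V x - reflB V y) (C := l * |x - y|) (fun z => by
    rw [BoundedContinuousFunction.sub_apply, reflB_apply, reflB_apply]
    refine (hV _ _).trans (le_of_eq ?_)
    congr 2; ring) v
  calc ‖u‖ * ‖mulOp (reflB V x - reflB V y) v‖ ≤ ‖u‖ * (l * |x - y| * ‖v‖) := by gcongr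
    _ = _ := by ring

lemma translB_potential (V : ℝ →ᵇ ℂ) (u v : L2R) (h : ℝ) :
    translB h (potential V u v) = potential V (transl h u) (transl h v) := by
  ext x
  have e : transl (-h) (mulOp (reflB V x) (transl h v)) = mulOp (reflB V (x + h)) v := by
    have : translB (-h) (reflB V x) = reflB V (x + h) := by
      ext y
      rw [translB_apply, reflB_apply, reflB_apply]
      congr 1; ring
    rw [transl_mulOp, transl_neg_transl, this]
  rw [translB_apply, potential_apply, potential_apply, ← e, inner_transl, neg_neg]

/-- Leibniz rule for the potential. -/
lemma dqB_potential (V : ℝ →ᵇ ℂ) (ħ h : ℝ) (u v : L2R) :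
    dqB ħ h (potential V u v)
      = potential V u (dq ħ h v) + potential V (dq ħ h u) (transl h v) := by
  ext x
  rw [dqB_apply, translB_potential]
  simp only [BoundedContinuousFunction.smul_apply, BoundedContinuousFunction.sub_apply,
    BoundedContinuousFunction.add_apply, potential_apply, dq_apply, map_smul, map_sub,
    inner_smul_left, inner_smul_right, inner_sub_left, inner_sub_right, smul_eq_mul,
    Complex.conj_ofReal]
  ring

/-- The difference quotients of the potential are controlled through the Lipschitz constant of
`V` alone: `V` absorbs one quotient, so that one order less falls on `u` and `v`. -/
lemma norm_iterate_dqB_potential_le {V : ℝ →ᵇ ℂ} {l ħ h a : ℝ} (hħ : 0 < ħ) (hh : 0 < h)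
    (hl : 0 ≤ l) (hV : ∀ a b, ‖V a - V b‖ ≤ l * |a - b|) (j : ℕ) {u v : L2R}
    (hu : ∀ i ≤ j, ‖(dq ħ h)^[i] u‖ ≤ a) (hv : ∀ i ≤ j, ‖(dq ħ h)^[i] v‖ ≤ a) (x : ℝ) :
    ‖(dqB ħ h)^[j + 1] (potential V u v) x‖ ≤ 2 ^ j * (ħ * l * a ^ 2) := by
  induction j generalizing u v with
  | zero =>
    have h1 : ‖u‖ ≤ a := hu 0 le_rfl
    have h2 : ‖v‖ ≤ a := hv 0 le_rfl
    have h3 := norm_potential_sub_le hV u v (x + h) x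
    rw [add_sub_cancel_left, abs_of_pos hh] at h3
    have ha : 0 ≤ a := (norm_nonneg _).trans h1
    rw [zero_add, Function.iterate_one, dqB_apply, BoundedContinuousFunction.smul_apply,
      BoundedContinuousFunction.sub_apply, translB_apply, norm_smul, Complex.norm_real,
      Real.norm_eq_abs, abs_of_pos (div_pos hħ hh), pow_zero, one_mul]
    calc ħ / h * ‖potential V u v (x + h) - potential V u v x‖
        ≤ ħ / h * (l * (a * a) * h) := by
          gcongr
          refine h3.trans (by gcongr)
      _ = ħ * l * a ^ 2 := by field_simp
  | succ j ih =>
    rw [Function.iterate_succ_apply, dqB_potential, iterate_map_add,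
      BoundedContinuousFunction.add_apply]
    have h1 := ih (u := u) (v := dq ħ h v) (fun i hi => hu i (by omega)) (fun i hi => by
      rw [← Function.iterate_succ_apply]; exact hv _ (by omega))
    have h2 := ih (u := dq ħ h u) (v := transl h v) (fun i hi => by
      rw [← Function.iterate_succ_apply]; exact hu _ (by omega)) (fun i hi => by
      rw [iterate_dq_transl, LinearIsometry.norm_map]; exact hv _ (by omega))
    refine (norm_add_le _ _).trans ((add_le_add h1 h2).trans (le_of_eq ?_))
    ring

lemma abs_screenedCoulomb_sub_le {σ : ℝ} (hσ : |σ| = 1) {ε : ℝ} (hε : 0 < ε) (a b : ℝ) :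
    |screenedCoulomb σ ε a - screenedCoulomb σ ε b| ≤ 1 / 2 * |a - b| := by
  have key : ∀ r ∈ Ici (0 : ℝ), ∀ s ∈ Ici (0 : ℝ),
      ‖s * Real.exp (-ε * s) - r * Real.exp (-ε * r)‖ ≤ 1 * ‖s - r‖ := by
    intro r hr s hs
    refine (convex_Ici (0 : ℝ)).norm_image_sub_le_of_norm_hasDerivWithin_le
      (f := fun s => s * Real.exp (-ε * s))
      (f' := fun s => 1 * Real.exp (-ε * s) + s * (Real.exp (-ε * s) * (-ε * 1)))
      (fun x _ => ?_) (fun x hx => ?_) hr hs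
    · exact ((hasDerivAt_id x).mul ((hasDerivAt_id x).const_mul (-ε)).exp).hasDerivWithinAt
    · have hx0 : 0 ≤ ε * x := mul_nonneg hε.le hx
      have e : 1 * Real.exp (-ε * x) + x * (Real.exp (-ε * x) * (-ε * 1))
          = (1 - ε * x) * Real.exp (-(ε * x)) := by rw [neg_mul]; ring
      rw [e, norm_mul, Real.norm_eq_abs, Real.norm_eq_abs, abs_of_pos (Real.exp_pos _),
        Real.exp_neg, ← div_eq_mul_inv, div_le_one (Real.exp_pos _), abs_le]
      have := Real.add_one_le_exp (ε * x)
      constructor <;> linarith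
  have h1 := key |b| (abs_nonneg b) |a| (abs_nonneg a)
  rw [one_mul, Real.norm_eq_abs, Real.norm_eq_abs] at h1
  have e : screenedCoulomb σ ε a - screenedCoulomb σ ε b
      = σ * (1 / 2 * (|a| * Real.exp (-ε * |a|) - |b| * Real.exp (-ε * |b|))) := by
    rw [screenedCoulomb, screenedCoulomb]; ring
  rw [e, abs_mul, hσ, one_mul, abs_mul, abs_of_pos (by norm_num : (0 : ℝ) < 1 / 2)]
  linarith [abs_abs_sub_abs_le_abs_sub a b]

lemma abs_screenedCoulomb_le {σ : ℝ} (hσ : |σ| = 1) {ε : ℝ} (hε : 0 < ε) (a : ℝ) :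
    |screenedCoulomb σ ε a| ≤ 1 / (2 * ε) := by
  have h1 : ε * |a| * Real.exp (-(ε * |a|)) ≤ 1 := by
    rw [Real.exp_neg, ← div_eq_mul_inv, div_le_one (Real.exp_pos _)]
    linarith [Real.add_one_le_exp (ε * |a|)]
  rw [screenedCoulomb, abs_mul, hσ, one_mul, abs_of_nonneg (by positivity),
    le_div_iff₀ (by positivity), neg_mul]
  linarith

/-- The screened Coulomb potential as a bounded continuous function. -/
def screenedCoulombB {σ : ℝ} (hσ : |σ| = 1) {ε : ℝ} (hε : 0 < ε) : ℝ →ᵇ ℂ :=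
  BoundedContinuousFunction.ofNormedAddCommGroup (fun x => (screenedCoulomb σ ε x : ℂ))
    (by unfold screenedCoulomb; fun_prop) (1 / (2 * ε)) (fun x => by
      rw [Complex.norm_real, Real.norm_eq_abs]
      exact abs_screenedCoulomb_le hσ hε x)

lemma screenedCoulombB_apply {σ : ℝ} (hσ : |σ| = 1) {ε : ℝ} (hε : 0 < ε) (x : ℝ) :
    screenedCoulombB hσ hε x = (screenedCoulomb σ ε x : ℂ) := rfl

lemma norm_screenedCoulombB_sub_le {σ : ℝ} (hσ : |σ| = 1) {ε : ℝ} (hε : 0 < ε) (a b : ℝ) :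
    ‖screenedCoulombB hσ hε a - screenedCoulombB hσ hε b‖ ≤ 1 / 2 * |a - b| := by
  rw [screenedCoulombB_apply, screenedCoulombB_apply, ← Complex.ofReal_sub, Complex.norm_real]
  exact abs_screenedCoulomb_sub_le hσ hε a b

lemma potential_eq_hartreePotential {σ : ℝ} (hσ : |σ| = 1) {ε : ℝ} (hε : 0 < ε) (u : L2R)
    (x : ℝ) : potential (screenedCoulombB hσ hε) u u x = (hartreePotential σ ε u x : ℂ) := by
  rw [potential_apply, inner_mulOp_reflB, hartreePotential, MeasureTheory.convolution_def,
    ← integral_complex_ofReal,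
    ← integral_sub_left_eq_self (fun y => screenedCoulombB hσ hε (x - y) * (u y * conj (u y)))
      volume x]
  congr 1
  ext y
  rw [sub_sub_cancel, screenedCoulombB_apply, Complex.mul_conj, Complex.normSq_eq_norm_sq]
  simp

/-! ### Weak derivatives in `L²` and difference quotients -/

lemma hasWeakDeriv_iff (k : ℕ) (u g : L2R) :
    HasWeakDeriv k u g ↔
      ∀ φ : Test, ⟪(Test.der^[k] φ).toL2, u⟫_ℂ = (-1) ^ k * ⟪φ.toL2, g⟫_ℂ := by
  have loc : ∀ w : L2R, LocallyIntegrable w volume := fun w =>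
    (Lp.memLp w).locallyIntegrable (by norm_num)
  have e : ∀ φ : Test, (∫ x, u x * iteratedDeriv k φ.1 x = (-1) ^ k * ∫ x, g x * φ.1 x) ↔
      ⟪(Test.der^[k] φ.conjTest).toL2, u⟫_ℂ = (-1) ^ k * ⟪φ.conjTest.toL2, g⟫_ℂ := by
    intro φ
    rw [Test.conjTest_iterate_der, Test.inner_conjTest, Test.inner_conjTest, Test.iterate_der]
  constructor
  · rintro ⟨-, -, H⟩ φ
    have hc : φ.conjTest.conjTest = φ := Subtype.ext (by simp [Test.conjTest])
    have := (e φ.conjTest).1 (H _ φ.conjTest.2)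
    rwa [hc] at this
  · intro H
    exact ⟨loc u, loc g, fun φ hφ => (e ⟨φ, hφ⟩).2 (H _)⟩

/-- A weak derivative with finite `L²` norm has a representative in `Lp`. -/
lemma HasWeakDeriv.exists_Lp {k : ℕ} {u : L2R} {g : ℝ → ℂ} (h : HasWeakDeriv k u g)
    (hg : eLpNorm g 2 volume < ⊤) : ∃ G : L2R, HasWeakDeriv k u G ∧ G =ᵐ[volume] g := by
  have hm : MemLp g 2 volume := ⟨h.2.1.aestronglyMeasurable, hg⟩
  refine ⟨hm.toLp g, ⟨h.1, (Lp.memLp _).locallyIntegrable (by norm_num), fun φ hφ => ?_⟩,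
    hm.coeFn_toLp⟩
  rw [h.2.2 φ hφ]
  congr 1
  apply integral_congr_ae
  filter_upwards [hm.coeFn_toLp] with x hx
  rw [hx]

/-- `g` is the weak derivative of `u`, both in `L²`, tested through the inner product. -/
def IsDer (u g : L2R) : Prop := ∀ φ : Test, ⟪φ.der.toL2, u⟫_ℂ = -⟪φ.toL2, g⟫_ℂ

lemma HasWeakDeriv.isDer {k : ℕ} {u g g' : L2R} (h : HasWeakDeriv k u g)
    (h' : HasWeakDeriv (k + 1) u g') : IsDer g g' := by
  intro φ
  have h1 := (hasWeakDeriv_iff _ _ _).1 h φ.der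
  have h2 := (hasWeakDeriv_iff _ _ _).1 h' φ
  rw [Function.iterate_succ_apply, h1, pow_succ, mul_assoc] at h2
  have := mul_left_cancel₀ (pow_ne_zero k (by norm_num)) h2
  rw [this]; ring

lemma HasWeakDeriv.eq_of_zero {u g : L2R} (h : HasWeakDeriv 0 u g) : g = u :=
  Test.ext_inner fun φ => by simpa using ((hasWeakDeriv_iff _ _ _).1 h φ).symm

/-- The fundamental theorem of calculus for weak derivatives. -/
lemma IsDer.transl_sub {u g : L2R} (h : IsDer u g) (d : ℝ) :
    transl d u - u = (d : ℂ) • avg d g := by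
  refine Test.ext_inner fun φ => ?_
  have h1 := Test.smul_toL2_der_steklov (-d) φ
  rw [inner_sub_right, inner_transl, ← inner_sub_left, ← h1, inner_smul_left, h, inner_smul_right,
    inner_avg, Test.toL2_steklov]
  simp

lemma dq_avg (ħ h d : ℝ) (u : L2R) : dq ħ h (avg d u) = avg d (dq ħ h u) := by
  simp only [dq_apply, map_smul, map_sub, avg_transl]

lemma norm_iterate_dq_le_of_isDer {ħ h : ℝ} (hħ : 0 < ħ) (hh : h ≠ 0) {G : ℕ → L2R}
    (hG : ∀ k, IsDer (G k) (G (k + 1))) (k j : ℕ) :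
    ‖(dq ħ h)^[k] (G j)‖ ≤ ħ ^ k * ‖G (j + k)‖ := by
  induction k generalizing j with
  | zero => simp
  | succ k ih =>
    have e : dq ħ h (G j) = (ħ : ℂ) • avg h (G (j + 1)) := by
      rw [dq_apply, (hG j).transl_sub, smul_smul, ← Complex.ofReal_mul, div_mul_cancel₀ _ hh]
    have h1 : ∀ v, (dq ħ h)^[k] (avg h v) = avg h ((dq ħ h)^[k] v) := fun v =>
      (Function.Commute.iterate_left (f := dq ħ h) (g := avg h) (dq_avg ħ h h) k) v
    have h2 : ∀ (c : ℂ) (v), (dq ħ h)^[k] (c • v) = c • (dq ħ h)^[k] v := fun c v => by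
      rw [← Module.End.coe_pow, map_smul]
    rw [Function.iterate_succ_apply, e, h2, h1, norm_smul, Complex.norm_real, Real.norm_eq_abs,
      abs_of_pos hħ, pow_succ', mul_assoc]
    gcongr
    refine (norm_avg_le _ _).trans ((ih (j + 1)).trans (le_of_eq ?_))
    rw [add_right_comm, add_assoc]

lemma tendsto_iterate_avg (k : ℕ) (u : L2R) :
    Tendsto (fun h => (avg h)^[k] u) (𝓝 0) (𝓝 u) := by
  induction k with
  | zero => exact tendsto_const_nhds
  | succ k ih =>
    simp only [Function.iterate_succ_apply']
    have h1 : Tendsto (fun h => avg h ((avg h)^[k] u - u)) (𝓝 0) (𝓝 0) :=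
      squeeze_zero_norm (fun h => norm_avg_le h _) (by simpa using (ih.sub_const u).norm)
    simpa using h1.add (tendsto_avg u)

lemma Test.iterate_der_steklov (h : ℝ) (k : ℕ) (φ : Test) :
    Test.der^[k] (φ.steklov h) = (Test.der^[k] φ).steklov h := by
  induction k with
  | zero => rfl
  | succ k ih =>
    rw [Function.iterate_succ_apply', Function.iterate_succ_apply', ih, Test.der_steklov]

lemma inner_iterate_dq {ħ h : ℝ} (hh : h ≠ 0) (k : ℕ) (φ : Test) (u : L2R) :
    ⟪φ.toL2, (dq ħ h)^[k] u⟫_ℂ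
      = (-(ħ : ℂ)) ^ k * ⟪(avg (-h))^[k] (Test.der^[k] φ).toL2, u⟫_ℂ := by
  induction k generalizing φ with
  | zero => simp
  | succ k ih =>
    have h1 := Test.smul_toL2_der_steklov (-h) φ
    have h2 : ∀ v : L2R, ⟪φ.toL2, dq ħ h v⟫_ℂ
        = -(ħ : ℂ) * ⟪(φ.steklov (-h)).der.toL2, v⟫_ℂ := by
      intro v
      rw [dq_apply, inner_smul_right, inner_sub_right, inner_transl, ← inner_sub_left, ← h1,
        inner_smul_left, Complex.conj_ofReal, ← mul_assoc, ← Complex.ofReal_mul]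
      congr 1
      rw [← Complex.ofReal_neg]
      congr 1
      field_simp
    rw [Function.iterate_succ_apply', h2, ih, ← Function.iterate_succ_apply (f := Test.der),
      Test.iterate_der_steklov, Test.toL2_steklov, ← Function.iterate_succ_apply (f := avg (-h))]
    ring

/-- Bounded families in a Hilbert space have weak cluster points (Banach–Alaoglu). -/
lemma exists_weak_limit {H : Type*} [NormedAddCommGroup H] [InnerProductSpace ℂ H]
    [CompleteSpace H] {A : ℝ} {b : ℝ → H} {l : Filter ℝ} [l.NeBot] (hb : ∀ᶠ h in l, ‖b h‖ ≤ A) :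
    ∃ g : H, ‖g‖ ≤ A ∧
      ∀ (φ : H) (c : ℂ), Tendsto (fun h => ⟪φ, b h⟫_ℂ) l (𝓝 c) → ⟪φ, g⟫_ℂ = c := by
  let F : ℝ → WeakDual ℂ H := fun h => StrongDual.toWeakDual (InnerProductSpace.toDual ℂ H (b h))
  obtain ⟨x, hx, hcl⟩ := (WeakDual.isCompact_closedBall (𝕜 := ℂ) (0 : StrongDual ℂ H) A)
    (f := l.map F) (by
      rw [le_principal_iff, mem_map]
      filter_upwards [hb] with h hh
      simpa [F] using hh)
  refine ⟨(InnerProductSpace.toDual ℂ H).symm (WeakDual.toStrongDual x), ?_, fun φ c hc => ?_⟩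
  · simpa using hx
  · have h1 : MapClusterPt (x φ) l (fun h => (F h) φ) :=
      MapClusterPt.tendsto_comp (u := F) (WeakDual.eval_continuous φ).continuousAt.tendsto hcl
    have h2 : Tendsto (fun h => (F h) φ) l (𝓝 (conj c)) := by
      have : ∀ h, (F h) φ = conj ⟪φ, b h⟫_ℂ := fun h => by
        rw [inner_conj_symm]; rfl
      simp only [this]
      exact (Complex.continuous_conj.tendsto c).comp hc
    have h3 : x φ = conj c := by
      by_contra hne
      have hd := (disjoint_nhds_nhds.2 hne)
      exact h1.neBot.ne (disjoint_iff.1 (hd.mono_right h2))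
    rw [← inner_conj_symm, InnerProductSpace.toDual_symm_apply]
    change conj (x φ) = c
    rw [h3, Complex.conj_conj]

/-- Bounded iterated difference quotients produce a weak derivative, with the same bound. -/
lemma exists_hasWeakDeriv_of_norm_iterate_dq_le {ħ A : ℝ} (hħ : 0 < ħ) (k : ℕ) (u : L2R)
    (hA : ∀ h > 0, ‖(dq ħ h)^[k] u‖ ≤ A) :
    ∃ g : L2R, HasWeakDeriv k u g ∧ ‖(ħ : ℂ) ^ k • g‖ ≤ A := by
  have hħ' : (ħ : ℂ) ^ k ≠ 0 := pow_ne_zero k (Complex.ofReal_ne_zero.2 hħ.ne')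
  obtain ⟨g, hg, H⟩ := exists_weak_limit (l := 𝓝[>] (0 : ℝ)) (b := fun h => (dq ħ h)^[k] u)
    (A := A) (by filter_upwards [self_mem_nhdsWithin] with h hh using hA h hh)
  refine ⟨((ħ : ℂ) ^ k)⁻¹ • g, (hasWeakDeriv_iff _ _ _).2 fun φ => ?_, by
    rwa [smul_inv_smul₀ hħ']⟩
  have lim : Tendsto (fun h => ⟪φ.toL2, (dq ħ h)^[k] u⟫_ℂ) (𝓝[>] 0)
      (𝓝 ((-(ħ : ℂ)) ^ k * ⟪(Test.der^[k] φ).toL2, u⟫_ℂ)) := by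
    have h1 : Tendsto (fun h : ℝ => (avg (-h))^[k] (Test.der^[k] φ).toL2) (𝓝[>] 0)
        (𝓝 (Test.der^[k] φ).toL2) := by
      have : Tendsto (fun d : ℝ => -d) (𝓝[>] 0) (𝓝 0) := by
        simpa using (continuous_neg.tendsto (0 : ℝ)).mono_left nhdsWithin_le_nhds
      exact (tendsto_iterate_avg k _).comp this
    refine (((h1.inner tendsto_const_nhds).const_mul _)).congr' ?_
    filter_upwards [self_mem_nhdsWithin] with h hh
    rw [inner_iterate_dq (ne_of_gt hh)]
  rw [inner_smul_right, H _ _ lim, neg_pow (ħ : ℂ)]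
  have h1 : ((-1 : ℂ) ^ k) * (-1) ^ k = 1 := by rw [← mul_pow]; norm_num
  generalize (-1 : ℂ) ^ k = r at h1 ⊢
  field_simp
  linear_combination (-⟪(Test.der^[k] φ).toL2, u⟫_ℂ) * h1

/-- Integration by parts for weak derivatives in `L²`. -/
lemma IsDer.inner_eq_neg {a a' b b' : L2R} (ha : IsDer a a') (hb : IsDer b b') :
    ⟪a', b⟫_ℂ = -⟪a, b'⟫_ℂ := by
  have key : ∀ h : ℝ, h ≠ 0 → ⟪avg h a', b⟫_ℂ = -⟪a, avg (-h) b'⟫_ℂ := by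
    intro h hh
    have h1 : ⟪transl h a - a, b⟫_ℂ = ⟪a, transl (-h) b - b⟫_ℂ := by
      rw [inner_sub_left, inner_sub_right, inner_transl, neg_neg]
    rw [ha.transl_sub, hb.transl_sub, inner_smul_left, inner_smul_right, Complex.conj_ofReal,
      Complex.ofReal_neg, neg_mul, ← mul_neg] at h1
    exact mul_left_cancel₀ (Complex.ofReal_ne_zero.2 hh) h1
  have hneg : Tendsto (fun d : ℝ => -d) (𝓝[>] 0) (𝓝 0) := by
    simpa using (continuous_neg.tendsto (0 : ℝ)).mono_left nhdsWithin_le_nhds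
  have l1 : Tendsto (fun h => ⟪avg h a', b⟫_ℂ) (𝓝[>] 0) (𝓝 ⟪a', b⟫_ℂ) :=
    ((tendsto_avg a').mono_left nhdsWithin_le_nhds).inner tendsto_const_nhds
  have l2 : Tendsto (fun h => -⟪a, avg (-h) b'⟫_ℂ) (𝓝[>] 0) (𝓝 (-⟪a, b'⟫_ℂ)) :=
    (tendsto_const_nhds.inner ((tendsto_avg b').comp hneg)).neg
  refine tendsto_nhds_unique (l1.congr' ?_) l2
  filter_upwards [self_mem_nhdsWithin] with h hh using key h (ne_of_gt hh)

lemma Test.toL2_mulSmooth {w : ℝ →ᵇ ℂ} (hw : ContDiff ℝ ∞ w) (φ : Test) :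
    (φ.mulSmooth w hw).toL2 = mulOp w φ.toL2 := by
  apply Lp.ext
  filter_upwards [(φ.mulSmooth w hw).coeFn_toL2, coeFn_mulOp w φ.toL2, φ.coeFn_toL2]
    with x h1 h2 h3
  rw [h1, h2, h3]; rfl

lemma Test.toL2_der_mulSmooth {w w' : ℝ →ᵇ ℂ} (hw : ContDiff ℝ ∞ w)
    (hw' : ∀ x, HasDerivAt w (w' x) x) (φ : Test) :
    (φ.mulSmooth w hw).der.toL2 = mulOp w' φ.toL2 + mulOp w φ.der.toL2 := by
  apply Lp.ext
  filter_upwards [(φ.mulSmooth w hw).der.coeFn_toL2, coeFn_mulOp w φ.der.toL2,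
    coeFn_mulOp w' φ.toL2, φ.coeFn_toL2, φ.der.coeFn_toL2,
    Lp.coeFn_add (mulOp w' φ.toL2) (mulOp w φ.der.toL2)] with x h1 h2 h3 h4 h5 h6
  rw [h1, h6, Pi.add_apply, h2, h3, h4, h5]
  exact ((hw' x).mul (φ.hasDerivAt x)).deriv

lemma contDiff_star {w : ℝ →ᵇ ℂ} (hw : ContDiff ℝ ∞ w) : ContDiff ℝ ∞ (star w : ℝ →ᵇ ℂ) :=
  Complex.conjCLE.contDiff.comp hw

lemma hasDerivAt_star {w w' : ℝ →ᵇ ℂ} (hw' : ∀ x, HasDerivAt w (w' x) x) (x : ℝ) :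
    HasDerivAt (star w : ℝ →ᵇ ℂ) ((star w' : ℝ →ᵇ ℂ) x) x :=
  Complex.conjCLE.toContinuousLinearMap.hasFDerivAt.comp_hasDerivAt x (hw' x)

lemma inner_mulOp_star (w : ℝ →ᵇ ℂ) (u v : L2R) :
    ⟪mulOp (star w) u, v⟫_ℂ = ⟪u, mulOp w v⟫_ℂ :=
  (inner_mulOp (fun _ => rfl) u v).symm

/-- Leibniz rule for a weak derivative times a smooth bounded function. -/
lemma IsDer.mulOp {a a' : L2R} (ha : IsDer a a') {w w' : ℝ →ᵇ ℂ} (hw : ContDiff ℝ ∞ w)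
    (hw' : ∀ x, HasDerivAt w (w' x) x) :
    IsDer (mulOp w a) (_root_.mulOp w' a + _root_.mulOp w a') := by
  intro φ
  have h1 := ha (φ.mulSmooth _ (contDiff_star hw))
  rw [Test.toL2_der_mulSmooth (contDiff_star hw) (hasDerivAt_star hw'), Test.toL2_mulSmooth,
    inner_add_left, inner_mulOp_star, inner_mulOp_star, inner_mulOp_star] at h1
  rw [inner_add_right]
  linear_combination h1

/-- A weak solution multiplied by a smooth weight is a weak solution, up to the commutator of the
weight with the kinetic term. -/
lemma IsWeakSol.mulOp {ħ T : ℝ} {u u' f : ℝ → L2R} (H : IsWeakSol ħ T u f)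
    (hu : ∀ t ∈ Icc 0 T, IsDer (u t) (u' t)) {m m' m'' : ℝ →ᵇ ℂ} (hm : ContDiff ℝ ∞ m)
    (hm' : ContDiff ℝ ∞ m') (hd : ∀ x, HasDerivAt m (m' x) x)
    (hd' : ∀ x, HasDerivAt m' (m'' x) x) :
    IsWeakSol ħ T (fun t => mulOp m (u t)) (fun t => _root_.mulOp m (f t)
      + ((1 / 2 : ℂ) * (ħ : ℂ) ^ 2)
        • ((2 : ℂ) • _root_.mulOp m' (u' t) + _root_.mulOp m'' (u t))) := by
  intro φ t ht
  have h0 := H (φ.mulSmooth _ (contDiff_star hm)) t ht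
  simp only [Test.toL2_mulSmooth, inner_mulOp_star] at h0
  refine h0.congr_deriv ?_
  congr 1
  have h1 := hu t ht (φ.mulSmooth _ (contDiff_star hm)).der
  rw [Test.toL2_der_mulSmooth (contDiff_star hm) (hasDerivAt_star hd), inner_add_left,
    inner_mulOp_star, inner_mulOp_star] at h1
  have h2 := (hu t ht).mulOp hm hd φ.der
  have h3 := (hu t ht).mulOp hm' hd' φ
  rw [inner_add_right] at h2 h3
  simp only [inner_add_right, inner_smul_right]
  linear_combination (-(1 / 2) * (ħ : ℂ) ^ 2) * (h1 - h2 + h3)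

/-! ### Propagation of the derivative bounds -/

lemma eLpNorm_eq_ofReal_norm {u : L2R} {f : ℝ → ℂ} (h : f =ᵐ[volume] u) :
    eLpNorm f 2 volume = ENNReal.ofReal ‖u‖ := by
  rw [eLpNorm_congr_ae h, Lp.norm_def, ENNReal.ofReal_toReal (Lp.eLpNorm_ne_top u)]

lemma norm_le_of_eLpNorm_le {u : L2R} {f : ℝ → ℂ} {C : ℝ} (hC : 0 ≤ C) (h : f =ᵐ[volume] u)
    (hf : eLpNorm f 2 volume ≤ ENNReal.ofReal C) : ‖u‖ ≤ C := by
  rw [eLpNorm_eq_ofReal_norm h] at hf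
  exact (ENNReal.ofReal_le_ofReal_iff hC).1 hf

lemma const_mul_ae_eq_smul {g : ℝ → ℂ} {G : L2R} (h : G =ᵐ[volume] g) (c : ℂ) :
    (fun x => c * g x) =ᵐ[volume] (c • G : L2R) := by
  filter_upwards [Lp.coeFn_smul c G, h] with x h1 h2
  rw [h1, Pi.smul_apply, h2, smul_eq_mul]

lemma IsAdmissibleDatum.exists_derivatives {ħ : ℝ} (hħ : 0 < ħ) {C₀ : ℝ≥0} {ψin : L2R}
    (h : IsAdmissibleDatum ħ C₀ ψin) :
    ∃ G : ℕ → L2R, (∀ k, HasWeakDeriv k ψin (G k)) ∧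
      ∀ k, ħ ^ k * ‖G k‖ ≤ (C₀ : ℝ) ^ k * (k : ℝ) ^ k := by
  have key : ∀ k, ∃ G : L2R, HasWeakDeriv k ψin G ∧
      ħ ^ k * ‖G‖ ≤ (C₀ : ℝ) ^ k * (k : ℝ) ^ k := by
    intro k
    obtain ⟨g, hg, hb⟩ := h.deriv_bound k
    have hħk : (ħ : ℂ) ^ k ≠ 0 := pow_ne_zero k (Complex.ofReal_ne_zero.2 hħ.ne')
    have hb' : eLpNorm (fun x : ℝ => (ħ : ℂ) ^ k * g x) 2 volume
        ≤ ENNReal.ofReal ((C₀ : ℝ) ^ k * (k : ℝ) ^ k) := by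
      rw [ENNReal.ofReal_mul (by positivity), ENNReal.ofReal_pow (by positivity),
        ENNReal.ofReal_pow (by positivity), ENNReal.ofReal_coe_nnreal, ENNReal.ofReal_natCast]
      exact hb
    have hfin : eLpNorm g 2 volume < ⊤ := by
      have e : g = ((ħ : ℂ) ^ k)⁻¹ • fun x => (ħ : ℂ) ^ k * g x := by
        ext x
        rw [Pi.smul_apply, smul_eq_mul, inv_mul_cancel_left₀ hħk]
      rw [e]
      refine (eLpNorm_const_smul_le).trans_lt (ENNReal.mul_lt_top (by simp) ?_)
      exact hb'.trans_lt ENNReal.ofReal_lt_top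
    obtain ⟨G, hG, hGg⟩ := hg.exists_Lp hfin
    refine ⟨G, hG, ?_⟩
    have := norm_le_of_eLpNorm_le (by positivity) (const_mul_ae_eq_smul hGg ((ħ : ℂ) ^ k)) hb'
    rwa [norm_smul, norm_pow, Complex.norm_real, Real.norm_eq_abs, abs_of_pos hħ] at this
  choose G hG using key
  exact ⟨G, fun k => (hG k).1, fun k => (hG k).2⟩

lemma IsHartreeSolution.isWeakSol {σ ħ ε T : ℝ} (hσ : |σ| = 1) (hħ : 0 < ħ) (hε : 0 < ε)
    {ψin : L2R} {ψ : ℝ → L2R} (h : IsHartreeSolution σ ħ ε T ψin ψ) :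
    IsWeakSol ħ T ψ
      (fun t => mulOp (potential (screenedCoulombB hσ hε) (ψ t) (ψ t)) (ψ t)) := by
  intro φ t ht
  have h1 := h.equation φ.conjTest.1 φ.conjTest.2 t ht
  have hc : (Complex.I * ħ) ≠ 0 := mul_ne_zero Complex.I_ne_zero (Complex.ofReal_ne_zero.2 hħ.ne')
  have h2 := h1.const_mul (Complex.I * ħ)⁻¹
  have e0 : ∀ u : L2R, ∫ x, u x * φ.conjTest.1 x = ⟪φ.toL2, u⟫_ℂ := fun u =>
    (Test.inner_toL2 φ u).symm
  simp only [inv_mul_cancel_left₀ hc, e0] at h2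
  refine h2.congr_deriv ?_
  congr 1
  have e2 : ∀ x, iteratedDeriv 2 φ.conjTest.1 x = conj (φ.der.der.1 x) := fun x => by
    rw [← Test.iterate_der, Test.conjTest_iterate_der]; rfl
  set p := potential (screenedCoulombB hσ hε) (ψ t) (ψ t) with hp
  have i1 : Integrable (fun x => ψ t x * conj (φ.der.der.1 x)) volume := by
    refine (L2.integrable_inner (𝕜 := ℂ) φ.der.der.toL2 (ψ t)).congr ?_
    filter_upwards [φ.der.der.coeFn_toL2] with x hx
    rw [hx]; rfl
  have i2 : Integrable (fun x => p x * ψ t x * conj (φ.1 x)) volume := by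
    refine (L2.integrable_inner (𝕜 := ℂ) φ.toL2 (mulOp p (ψ t))).congr ?_
    filter_upwards [φ.coeFn_toL2, coeFn_mulOp p (ψ t)] with x hx hx'
    rw [hx, hx']; rfl
  have e3 : ∀ x, (hartreePotential σ ε (ψ t) x : ℂ) = p x := fun x =>
    (potential_eq_hartreePotential hσ hε (ψ t) x).symm
  simp only [e2, e3]
  have e4 : ∀ x, φ.conjTest.1 x = conj (φ.1 x) := fun x => rfl
  simp only [e4]
  rw [integral_add (i1.const_mul _) i2, integral_const_mul, ← Test.inner_toL2]
  congr 1
  rw [Test.inner_toL2]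
  apply integral_congr_ae
  filter_upwards [coeFn_mulOp p (ψ t)] with x hx
  rw [hx]

/-- The constants bounding `‖(ħ∂ₓ)ᵏ ψ(t)‖`, given by the recursion that the commutator estimate
produces. -/
def derivBound (C T : ℝ) : ℕ → ℝ
  | 0 => 1
  | k + 1 => derivBound C T k + C ^ (k + 1) * ((k + 1 : ℕ) : ℝ) ^ (k + 1)
      + T * (2 ^ (k + 1) * (2 ^ k * (1 / 2 * derivBound C T k ^ 2) * derivBound C T k))

lemma derivBound_nonneg {C T : ℝ} (hC : 0 ≤ C) (hT : 0 ≤ T) (k : ℕ) : 0 ≤ derivBound C T k := by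
  induction k with
  | zero => exact zero_le_one
  | succ k ih => rw [derivBound]; positivity

lemma derivBound_le_succ {C T : ℝ} (hC : 0 ≤ C) (hT : 0 ≤ T) (k : ℕ) :
    derivBound C T k ≤ derivBound C T (k + 1) := by
  have h := derivBound_nonneg hC hT k
  rw [derivBound, add_assoc, le_add_iff_nonneg_right]
  positivity

/-- The difference quotients of a solution are bounded uniformly in the step `h`, in `ħ` and
in the screening parameter. -/
lemma IsHartreeSolution.norm_iterate_dq_le {σ ħ ε T : ℝ} (hσ : |σ| = 1) (hħ : 0 < ħ)
    (hε : 0 < ε) (hT : 0 ≤ T) {C₀ : ℝ≥0} {ψin : L2R} {ψ : ℝ → L2R}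
    (h : IsHartreeSolution σ ħ ε T ψin ψ) (hin : IsAdmissibleDatum ħ C₀ ψin) (k : ℕ) :
    ∀ j ≤ k, ∀ t ∈ Icc 0 T, ∀ d > 0, ‖(dq ħ d)^[j] (ψ t)‖ ≤ derivBound C₀ T k := by
  -- `K`, and bounds depending on the screening or the step, enter only qualitatively
  obtain ⟨K, hK⟩ := isCompact_Icc.exists_bound_of_continuousOn h.continuousOn
  set V := screenedCoulombB hσ hε
  have hV := norm_screenedCoulombB_sub_le hσ hε
  have hK0 : 0 ≤ K := (norm_nonneg _).trans (hK 0 ⟨le_rfl, hT⟩)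
  have hsol : IsWeakSol ħ T ψ (fun t => mulOp (potential V (ψ t) (ψ t)) (ψ t)) :=
    h.isWeakSol hσ hħ hε
  have hreal : ∀ t ∈ Icc 0 T, ∀ x, conj (potential V (ψ t) (ψ t) x)
      = potential V (ψ t) (ψ t) x := fun t _ x => by
    rw [potential_eq_hartreePotential, Complex.conj_ofReal]
  have hB : ∀ t ∈ Icc 0 T, ∀ x, ‖potential V (ψ t) (ψ t) x‖ ≤ ‖V‖ * (K * K) := fun t ht x =>
    (norm_potential_le V _ _ x).trans (by gcongr <;> exact hK t ht)
  have hL : ∀ t ∈ Icc 0 T, ∀ x y, ‖potential V (ψ t) (ψ t) x - potential V (ψ t) (ψ t) y‖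
      ≤ 1 / 2 * (K * K) * |x - y| := fun t ht x y =>
    (norm_potential_sub_le hV _ _ x y).trans (by gcongr <;> exact hK t ht)
  obtain ⟨G, hG, hGb⟩ := hin.exists_derivatives hħ
  induction k with
  | zero =>
    intro j hj t ht d _
    obtain rfl : j = 0 := by omega
    have := hsol.norm_le hħ hreal hB hL hK (M := 0) (fun s _ => by simp) ht
    rw [h.initial, hin.normalized] at this
    simpa [derivBound] using this
  | succ k ih =>
    intro j hj t ht d hd
    -- the commutator is `O(ħ)` and contains differences of `ψ` of order at most `k`
    set A := derivBound C₀ T k with hA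
    have hA0 : 0 ≤ A := derivBound_nonneg C₀.2 hT k
    rcases hj.lt_or_eq with hlt | rfl
    · exact (ih j (by omega) t ht d hd).trans (derivBound_le_succ C₀.2 hT k)
    have hM : ∀ s ∈ Icc 0 T,
        ‖(dq ħ d)^[k + 1] (mulOp (potential V (ψ s) (ψ s)) (ψ s))
          - mulOp (potential V (ψ s) (ψ s)) ((dq ħ d)^[k + 1] (ψ s))‖
        ≤ 2 ^ (k + 1) * (2 ^ k * (ħ * (1 / 2) * A ^ 2) * A) := by
      intro s hs
      refine norm_iterate_dq_mulOp_sub_le (by positivity) (k + 1) (fun i hi hi' x => ?_) hA0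
        (fun i hi => ih i (by omega) s hs d hd)
      obtain ⟨i, rfl⟩ : ∃ l, i = l + 1 := ⟨i - 1, by omega⟩
      refine (norm_iterate_dqB_potential_le hħ hd (by norm_num) hV i (a := A)
        (fun l hl => ih l (by omega) s hs d hd) (fun l hl => ih l (by omega) s hs d hd) x).trans ?_
      gcongr
      · norm_num
      · omega
    have key := (hsol.iterate_dq d (k + 1)).norm_le hħ hreal hB hL
      (K := (2 * |ħ / d|) ^ (k + 1) * K)
      (fun s hs => (_root_.norm_iterate_dq_le (k + 1) (ψ s)).trans (by gcongr; exact hK s hs))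
      hM ht
    have h0 : ‖(dq ħ d)^[k + 1] (ψ 0)‖
        ≤ (C₀ : ℝ) ^ (k + 1) * ((k + 1 : ℕ) : ℝ) ^ (k + 1) := by
      have h1 := norm_iterate_dq_le_of_isDer hħ hd.ne'
        (fun i => (hG i).isDer (hG (i + 1))) (k + 1) 0
      rw [(hG 0).eq_of_zero, zero_add] at h1
      rw [h.initial]
      exact h1.trans (hGb (k + 1))
    have e : 2 ^ (k + 1) * (2 ^ k * (ħ * (1 / 2) * A ^ 2) * A) / ħ
        = 2 ^ (k + 1) * (2 ^ k * (1 / 2 * A ^ 2) * A) := by field_simp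
    rw [e] at key
    have hmono : t * (2 ^ (k + 1) * (2 ^ k * (1 / 2 * A ^ 2) * A))
        ≤ T * (2 ^ (k + 1) * (2 ^ k * (1 / 2 * A ^ 2) * A)) := by
      gcongr
      exact ht.2
    rw [derivBound, ← hA]
    linarith

/-- The solution has weak derivatives of all orders, uniformly bounded in `L²`. -/
lemma IsHartreeSolution.exists_derivatives {σ ħ ε T : ℝ} (hσ : |σ| = 1) (hħ : 0 < ħ)
    (hε : 0 < ε) (hT : 0 ≤ T) {C₀ : ℝ≥0} {ψin : L2R} {ψ : ℝ → L2R}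
    (h : IsHartreeSolution σ ħ ε T ψin ψ) (hin : IsAdmissibleDatum ħ C₀ ψin) :
    ∃ G : ℝ → ℕ → L2R, ∀ t ∈ Icc 0 T, ∀ k, HasWeakDeriv k (ψ t) (G t k) ∧
      ħ ^ k * ‖G t k‖ ≤ derivBound C₀ T k := by
  have key : ∀ t : ℝ, ∀ k : ℕ, ∃ g : L2R, t ∈ Icc 0 T → HasWeakDeriv k (ψ t) g ∧
      ħ ^ k * ‖g‖ ≤ derivBound C₀ T k := by
    intro t k
    by_cases ht : t ∈ Icc 0 T
    · obtain ⟨g, hg, hb⟩ := exists_hasWeakDeriv_of_norm_iterate_dq_le hħ k (ψ t)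
        (h.norm_iterate_dq_le hσ hħ hε hT hin k k le_rfl t ht)
      rw [norm_smul, norm_pow, Complex.norm_real, Real.norm_eq_abs, abs_of_pos hħ] at hb
      exact ⟨g, fun _ => ⟨hg, hb⟩⟩
    · exact ⟨0, fun ht' => absurd ht' ht⟩
  choose G hG using key
  exact ⟨G, fun t ht k => hG t k ht⟩

/-! ### Propagation of the second moment -/

/-- The bounded weight `x / (1 + iκx)`, an approximation of `x` as `κ → 0`. The complex
denominator keeps the derivatives rational while `|1 + iκx| ≥ 1`. -/
def momentWeight (κ x : ℝ) : ℂ := x / (1 + κ * x * Complex.I)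

lemma normSq_momentDenom (κ x : ℝ) : ‖(1 + κ * x * Complex.I : ℂ)‖ ^ 2 = 1 + (κ * x) ^ 2 := by
  rw [← Complex.normSq_eq_norm_sq, Complex.normSq_apply]
  simp
  ring

lemma one_le_norm_momentDenom (κ x : ℝ) : 1 ≤ ‖(1 + κ * x * Complex.I : ℂ)‖ := by
  nlinarith [normSq_momentDenom κ x, sq_nonneg (κ * x), norm_nonneg (1 + κ * x * Complex.I : ℂ)]

lemma abs_le_norm_momentDenom (κ x : ℝ) : |κ * x| ≤ ‖(1 + κ * x * Complex.I : ℂ)‖ :=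
  abs_le_of_sq_le_sq (by rw [normSq_momentDenom]; linarith) (norm_nonneg _)

lemma momentDenom_ne_zero (κ x : ℝ) : (1 + κ * x * Complex.I : ℂ) ≠ 0 := fun h => by
  have := one_le_norm_momentDenom κ x
  rw [h, norm_zero] at this
  linarith

lemma norm_inv_momentDenom_le (κ x : ℝ) : ‖(1 + κ * x * Complex.I : ℂ)⁻¹‖ ≤ 1 := by
  rw [norm_inv]
  exact inv_le_one_of_one_le₀ (one_le_norm_momentDenom κ x)

lemma norm_momentWeight_le (κ x : ℝ) : ‖momentWeight κ x‖ ≤ |x| := by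
  rw [momentWeight, div_eq_mul_inv, norm_mul, Complex.norm_real, Real.norm_eq_abs]
  exact mul_le_of_le_one_right (abs_nonneg _) (norm_inv_momentDenom_le κ x)

lemma contDiff_momentDenom (κ : ℝ) : ContDiff ℝ ∞ fun x : ℝ => (1 + κ * x * Complex.I : ℂ) :=
  contDiff_const.add ((contDiff_const.mul Complex.ofRealCLM.contDiff).mul contDiff_const)

lemma contDiff_inv_momentDenom (κ : ℝ) :
    ContDiff ℝ ∞ fun x : ℝ => (1 + κ * x * Complex.I : ℂ)⁻¹ :=
  (contDiff_momentDenom κ).inv (momentDenom_ne_zero κ)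

lemma momentWeight_eq (κ : ℝ) :
    momentWeight κ = fun x : ℝ => (x : ℂ) * (1 + κ * x * Complex.I : ℂ)⁻¹ := by
  ext x; rw [momentWeight, div_eq_mul_inv]

lemma contDiff_momentWeight (κ : ℝ) : ContDiff ℝ ∞ (momentWeight κ) := by
  rw [momentWeight_eq]
  exact Complex.ofRealCLM.contDiff.mul (contDiff_inv_momentDenom κ)

lemma hasDerivAt_inv_momentDenom (κ x : ℝ) :
    HasDerivAt (fun x : ℝ => (1 + κ * x * Complex.I : ℂ)⁻¹)
      (-(κ * Complex.I) * ((1 + κ * x * Complex.I : ℂ)⁻¹) ^ 2) x := by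
  have h1 : HasDerivAt (fun x : ℝ => (1 + κ * x * Complex.I : ℂ)) (κ * 1 * Complex.I) x :=
    (((Complex.ofRealCLM.hasDerivAt (x := x)).const_mul (κ : ℂ)).mul_const Complex.I).const_add 1
  refine (h1.inv (momentDenom_ne_zero κ x)).congr_deriv ?_
  rw [mul_one, div_eq_mul_inv, inv_pow]

lemma hasDerivAt_momentWeight (κ x : ℝ) :
    HasDerivAt (momentWeight κ) (((1 + κ * x * Complex.I : ℂ)⁻¹) ^ 2) x := by
  have h1 := (Complex.ofRealCLM.hasDerivAt (x := x)).mul (hasDerivAt_inv_momentDenom κ x)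
  rw [momentWeight_eq]
  refine h1.congr_deriv ?_
  have := momentDenom_ne_zero κ x
  simp only [Complex.ofRealCLM_apply, Complex.ofReal_one]
  field_simp
  ring

/-- The energy inequality for `momentWeight κ • ψ` bounds the moment through the first derivative,
uniformly in `κ`. -/
lemma IsHartreeSolution.eLpNorm_moment_le {σ ħ ε T : ℝ} (hσ : |σ| = 1) (hħ : 0 < ħ)
    (hħ1 : ħ ≤ 1) (hε : 0 < ε) (hT : 0 ≤ T) {C₀ : ℝ≥0} {ψin : L2R} {ψ : ℝ → L2R}
    (h : IsHartreeSolution σ ħ ε T ψin ψ) (hin : IsAdmissibleDatum ħ C₀ ψin) {t : ℝ}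
    (ht : t ∈ Icc 0 T) :
    eLpNorm (fun x : ℝ => (x : ℂ) * ψ t x) 2 volume
      ≤ ENNReal.ofReal (C₀ + T * (derivBound C₀ T 1 + 1)) := by
  obtain ⟨K, hK⟩ := isCompact_Icc.exists_bound_of_continuousOn h.continuousOn
  obtain ⟨G, hG⟩ := h.exists_derivatives hσ hħ hε hT hin
  have hK0 : 0 ≤ K := (norm_nonneg _).trans (hK t ht)
  set V := screenedCoulombB hσ hε
  have hsol : IsWeakSol ħ T ψ (fun t => mulOp (potential V (ψ t) (ψ t)) (ψ t)) :=
    h.isWeakSol hσ hħ hε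
  have main : ∀ κ : ℝ, 0 < κ → κ ≤ 1 →
      eLpNorm (fun x : ℝ => momentWeight κ x * ψ t x) 2 volume
        ≤ ENNReal.ofReal (C₀ + T * (derivBound C₀ T 1 + 1)) := by
    intro κ hκ hκ1
    have hmb : ∀ x, ‖momentWeight κ x‖ ≤ κ⁻¹ := fun x => by
      rw [momentWeight, norm_div, Complex.norm_real, Real.norm_eq_abs,
        div_le_iff₀ (by linarith [one_le_norm_momentDenom κ x])]
      have := abs_le_norm_momentDenom κ x
      rw [abs_mul, abs_of_pos hκ] at this
      rw [inv_mul_eq_div, le_div_iff₀ hκ]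
      linarith
    have hb1 : ∀ x : ℝ, ‖((1 + κ * x * Complex.I : ℂ)⁻¹) ^ 2‖ ≤ 1 := fun x => by
      rw [norm_pow]
      exact pow_le_one₀ (norm_nonneg _) (norm_inv_momentDenom_le κ x)
    have hb2 : ∀ x : ℝ, ‖-(2 * κ * Complex.I) * ((1 + κ * x * Complex.I : ℂ)⁻¹) ^ 3‖ ≤ 2 :=
      fun x => by
      rw [norm_mul, norm_pow, norm_neg, norm_mul, norm_mul, Complex.norm_I, mul_one,
        Complex.norm_real, Complex.norm_ofNat, Real.norm_eq_abs, abs_of_pos hκ]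
      have := pow_le_one₀ (n := 3) (norm_nonneg _) (norm_inv_momentDenom_le κ x)
      nlinarith
    let m : ℝ →ᵇ ℂ := BoundedContinuousFunction.ofNormedAddCommGroup (momentWeight κ)
      (contDiff_momentWeight κ).continuous κ⁻¹ hmb
    let m' : ℝ →ᵇ ℂ := BoundedContinuousFunction.ofNormedAddCommGroup
      (fun x : ℝ => ((1 + κ * x * Complex.I : ℂ)⁻¹) ^ 2)
      ((contDiff_inv_momentDenom κ).pow 2).continuous 1 hb1
    let m'' : ℝ →ᵇ ℂ := BoundedContinuousFunction.ofNormedAddCommGroup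
      (fun x : ℝ => -(2 * κ * Complex.I) * ((1 + κ * x * Complex.I : ℂ)⁻¹) ^ 3)
      (contDiff_const.mul ((contDiff_inv_momentDenom κ).pow 3)).continuous 2 hb2
    have hd' : ∀ x, HasDerivAt m' (m'' x) x := fun x => by
      refine ((hasDerivAt_inv_momentDenom κ x).pow 2).congr_deriv ?_
      change _ = -(2 * κ * Complex.I) * ((1 + κ * x * Complex.I : ℂ)⁻¹) ^ 3
      generalize (1 + κ * x * Complex.I : ℂ)⁻¹ = z
      norm_num
      ring
    have hw := hsol.mulOp (u' := fun t => G t 1) (m := m) (m' := m') (m'' := m'')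
      (fun s hs => by
        have h0 := ((hG s hs 0).1).isDer (hG s hs 1).1
        rwa [((hG s hs 0).1).eq_of_zero] at h0)
      (contDiff_momentWeight κ) ((contDiff_inv_momentDenom κ).pow 2)
      (hasDerivAt_momentWeight κ) hd'
    have key := hw.norm_le (W := fun t => potential V (ψ t) (ψ t)) (B := ‖V‖ * (K * K))
      (L := 1 / 2 * (K * K)) (K := κ⁻¹ * K) (M := ħ * (derivBound C₀ T 1 + 1)) hħ
      (fun s _ x => by rw [potential_eq_hartreePotential, Complex.conj_ofReal])
      (fun s hs x => (norm_potential_le V _ _ x).trans (by gcongr <;> exact hK s hs))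
      (fun s hs x y => (norm_potential_sub_le (norm_screenedCoulombB_sub_le hσ hε) _ _ x y).trans
        (by gcongr <;> exact hK s hs))
      (fun s hs => (norm_mulOp_le hmb _).trans (by gcongr; exact hK s hs))
      (fun s hs => by
        rw [mulOp_comm, add_sub_cancel_left, norm_smul]
        have h1 := (norm_mulOp_le (w := m') hb1 (G s 1))
        have h2 := (norm_mulOp_le (w := m'') hb2 (ψ s))
        have h3 := norm_add_le ((2 : ℂ) • mulOp m' (G s 1)) (mulOp m'' (ψ s))
        have h4 := (hG s hs 1).2
        have h5 : ‖ψ s‖ ≤ 1 :=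
          h.norm_iterate_dq_le hσ hħ hε hT hin 0 0 le_rfl s hs 1 one_pos
        rw [norm_smul, Complex.norm_ofNat] at h3
        rw [pow_one] at h4
        have h6 : ‖((1 / 2 : ℂ) * (ħ : ℂ) ^ 2)‖ = 1 / 2 * ħ ^ 2 := by
          rw [norm_mul, norm_pow, Complex.norm_real, Real.norm_eq_abs, abs_of_pos hħ]
          norm_num
        rw [h6]
        calc 1 / 2 * ħ ^ 2 * ‖(2 : ℂ) • mulOp m' (G s 1) + mulOp m'' (ψ s)‖
            ≤ 1 / 2 * ħ ^ 2 * (2 * ‖G s 1‖ + 2 * 1) := by gcongr; linarith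
          _ = ħ * (ħ * ‖G s 1‖ + ħ) := by ring
          _ ≤ ħ * (derivBound C₀ T 1 + 1) := by gcongr) ht
    have h0 : ‖mulOp m (ψ 0)‖ ≤ C₀ := by
      have h1 : eLpNorm (mulOp m (ψ 0)) 2 volume ≤ ENNReal.ofReal (C₀ : ℝ) := by
        rw [ENNReal.ofReal_coe_nnreal]
        refine (eLpNorm_mono_ae ?_).trans hin.moment
        rw [h.initial]
        filter_upwards [coeFn_mulOp m ψin] with x hx
        rw [hx, norm_mul, norm_mul, Complex.norm_real, Real.norm_eq_abs, abs_abs]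
        exact mul_le_mul_of_nonneg_right (norm_momentWeight_le κ x) (norm_nonneg _)
      exact norm_le_of_eLpNorm_le C₀.2 (ae_eq_refl _) h1
    refine (eLpNorm_eq_ofReal_norm (u := mulOp m (ψ t)) (coeFn_mulOp m (ψ t)).symm).trans_le ?_
    refine ENNReal.ofReal_le_ofReal (key.trans (add_le_add h0 ?_))
    rw [mul_div_cancel_left₀ _ hħ.ne']
    have := derivBound_nonneg C₀.2 hT 1
    gcongr
    exact ht.2
  refine Lp.eLpNorm_le_of_ae_tendsto (u := 𝓝[>] (0 : ℝ))
    (f := fun κ x => momentWeight κ x * ψ t x) ?_ (fun κ => ?_)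
    (Eventually.of_forall fun x => ?_)
  · filter_upwards [Ioc_mem_nhdsGT one_pos] with κ hκ using main κ hκ.1 hκ.2
  · exact (contDiff_momentWeight κ).continuous.aestronglyMeasurable.mul
      (Lp.aestronglyMeasurable _)
  · refine Tendsto.mul_const _ ?_
    have : ContinuousAt (fun κ : ℝ => momentWeight κ x) 0 := by
      unfold momentWeight
      exact ContinuousAt.div (by fun_prop) (by fun_prop) (momentDenom_ne_zero 0 x)
    have h1 := this.tendsto.mono_left (nhdsWithin_le_nhds (s := Ioi 0))
    simpa [momentWeight] using h1

/-! ### Weighted bounds on the derivatives -/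

lemma bracket_pos (x : ℝ) : 0 < bracket x := Real.sqrt_pos.2 (by positivity)

lemma bracket_sq (x : ℝ) : bracket x ^ 2 = 1 + x ^ 2 := Real.sq_sqrt (by positivity)

lemma bracket_le (x : ℝ) : bracket x ≤ 1 + |x| :=
  Real.sqrt_le_iff.2 ⟨by positivity, by nlinarith [sq_abs x, abs_nonneg x]⟩

lemma abs_le_bracket (x : ℝ) : |x| ≤ bracket x :=
  Real.abs_le_sqrt (by linarith)

lemma one_le_bracket (x : ℝ) : 1 ≤ bracket x :=
  Real.one_le_sqrt.2 (by nlinarith [sq_nonneg x])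

lemma contDiff_bracket : ContDiff ℝ ∞ bracket :=
  (contDiff_const.add (contDiff_id.pow 2)).sqrt fun x => by positivity

lemma hasDerivAt_bracket (x : ℝ) : HasDerivAt bracket (x / bracket x) x := by
  have h1 : HasDerivAt (fun x : ℝ => 1 + x ^ 2) (2 * x) x := by
    simpa using (hasDerivAt_pow 2 x).const_add 1
  refine (h1.sqrt (by positivity)).congr_deriv ?_
  rw [mul_div_mul_left _ _ two_ne_zero]; rfl

/-- The bounded weight `⟨x⟩ / (1 + κx²)`, an approximation of `⟨x⟩` as `κ → 0`. -/
def bracketWeight (κ x : ℝ) : ℝ := bracket x / (1 + κ * x ^ 2)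

lemma bracketWeight_nonneg {κ : ℝ} (hκ : 0 < κ) (x : ℝ) : 0 ≤ bracketWeight κ x :=
  div_nonneg (bracket_pos x).le (by positivity)

lemma bracketWeight_le {κ : ℝ} (hκ : 0 < κ) (x : ℝ) : bracketWeight κ x ≤ bracket x :=
  div_le_self (bracket_pos x).le (by nlinarith [mul_nonneg hκ.le (sq_nonneg x)])

lemma bracketWeight_le_inv {κ : ℝ} (hκ : 0 < κ) (hκ1 : κ ≤ 1) (x : ℝ) :
    bracketWeight κ x ≤ κ⁻¹ := by
  rw [bracketWeight, div_le_iff₀ (by positivity), inv_mul_eq_div, le_div_iff₀ hκ]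
  nlinarith [one_le_bracket x, bracket_sq x, mul_le_mul_of_nonneg_right
    (by nlinarith [one_le_bracket x] : bracket x ≤ bracket x ^ 2) hκ.le]

lemma contDiff_bracketWeight {κ : ℝ} (hκ : 0 < κ) : ContDiff ℝ ∞ (bracketWeight κ) :=
  contDiff_bracket.div (contDiff_const.add (contDiff_const.mul (contDiff_id.pow 2)))
    fun x => (by positivity : (0 : ℝ) < 1 + κ * x ^ 2).ne'

/-- The derivative of `bracketWeight`. -/
def bracketWeightDeriv (κ x : ℝ) : ℝ :=
  (x / bracket x * (1 + κ * x ^ 2) - bracket x * (κ * (2 * x))) / (1 + κ * x ^ 2) ^ 2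

lemma hasDerivAt_bracketWeight {κ : ℝ} (hκ : 0 < κ) (x : ℝ) :
    HasDerivAt (bracketWeight κ) (bracketWeightDeriv κ x) x := by
  have h1 : HasDerivAt (fun x : ℝ => 1 + κ * x ^ 2) (κ * (2 * x)) x := by
    simpa using ((hasDerivAt_pow 2 x).const_mul κ).const_add 1
  exact (hasDerivAt_bracket x).div h1 (by positivity)

lemma abs_bracketWeightDeriv_le {κ : ℝ} (hκ : 0 < κ) (hκ1 : κ ≤ 1) (x : ℝ) :
    |bracketWeightDeriv κ x| ≤ 3 := by
  have hb := bracket_pos x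
  set q := 1 + κ * x ^ 2 with hq
  have hq1 : 1 ≤ q := by nlinarith [mul_nonneg hκ.le (sq_nonneg x)]
  have h1 : |x / bracket x| ≤ 1 := by
    rw [abs_div, abs_of_pos hb, div_le_one hb]; exact abs_le_bracket x
  have h2 : bracket x * |x| ≤ 1 + x ^ 2 := by
    rw [← bracket_sq, pow_two]; gcongr; exact abs_le_bracket x
  have h3 : |bracket x * (κ * (2 * x))| ≤ 2 * q := by
    rw [abs_mul, abs_mul, abs_mul, abs_of_pos hb, abs_of_pos hκ, abs_two]
    nlinarith [mul_le_mul_of_nonneg_left h2 hκ.le]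
  rw [bracketWeightDeriv, ← hq, abs_div, abs_of_pos (by positivity : 0 < q ^ 2),
    div_le_iff₀ (by positivity)]
  refine (abs_sub _ _).trans ?_
  rw [abs_mul, abs_of_pos (by linarith : 0 < q)]
  nlinarith

/-- The constants produced by shifting derivatives one at a time from the left to the right
factor of `⟪(ħ∂ₓ)ˡ u, ⟨x⟩ (ħ∂ₓ)ʲ u⟫`. -/
def weightedBound (A : ℕ → ℝ) (c : ℝ) : ℕ → ℕ → ℝ
  | 0, j => c * A j
  | l + 1, j => 3 * (A l * A j) + weightedBound A c l (j + 1)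

lemma norm_inner_mulOp_le_weightedBound {ħ c : ℝ} (hħ : 0 < ħ) (hħ1 : ħ ≤ 1) {A : ℕ → ℝ}
    {G : ℕ → L2R} (hG : ∀ k, IsDer (G k) (G (k + 1))) (hA : ∀ k, ħ ^ k * ‖G k‖ ≤ A k)
    {w w' : ℝ →ᵇ ℂ} (hw : ContDiff ℝ ∞ w) (hd : ∀ x, HasDerivAt w (w' x) x)
    (hw' : ∀ x, ‖w' x‖ ≤ 3) (hc : ‖mulOp (star w) (G 0)‖ ≤ c) (l j : ℕ) :
    ħ ^ (l + j) * ‖⟪G l, mulOp w (G j)⟫_ℂ‖ ≤ weightedBound A c l j := by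
  have hc0 : 0 ≤ c := (norm_nonneg _).trans hc
  induction l generalizing j with
  | zero =>
    rw [← inner_mulOp_star, weightedBound, zero_add]
    calc ħ ^ j * ‖⟪mulOp (star w) (G 0), G j⟫_ℂ‖ ≤ ħ ^ j * (c * ‖G j‖) := by
          gcongr
          exact (norm_inner_le_norm _ _).trans (by gcongr)
      _ = c * (ħ ^ j * ‖G j‖) := by ring
      _ ≤ c * A j := by gcongr; exact hA j
  | succ l ih =>
    rw [(hG l).inner_eq_neg ((hG j).mulOp hw hd), norm_neg, inner_add_right, weightedBound]
    have h1 : ‖⟪G l, mulOp w' (G j)⟫_ℂ‖ ≤ ‖G l‖ * (3 * ‖G j‖) :=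
      (norm_inner_le_norm _ _).trans (by gcongr; exact norm_mulOp_le hw' _)
    have h2 := ih (j + 1)
    have hl0 : 0 ≤ ħ ^ l * ‖G l‖ := by positivity
    have h3 : ħ ^ (l + 1 + j) * ‖⟪G l, mulOp w' (G j)⟫_ℂ‖ ≤ 3 * (A l * A j) := by
      calc ħ ^ (l + 1 + j) * ‖⟪G l, mulOp w' (G j)⟫_ℂ‖
          ≤ ħ ^ (l + 1 + j) * (‖G l‖ * (3 * ‖G j‖)) := by gcongr
        _ = ħ * (3 * ((ħ ^ l * ‖G l‖) * (ħ ^ j * ‖G j‖))) := by ring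
        _ ≤ 1 * (3 * ((ħ ^ l * ‖G l‖) * (ħ ^ j * ‖G j‖))) := by gcongr
        _ = 3 * ((ħ ^ l * ‖G l‖) * (ħ ^ j * ‖G j‖)) := one_mul _
        _ ≤ 3 * (A l * A j) := by
          gcongr
          · exact hl0.trans (hA l)
          · exact hA l
          · exact hA j
    have h4 : l + 1 + j = l + (j + 1) := by ring
    calc ħ ^ (l + 1 + j) * ‖⟪G l, mulOp w' (G j)⟫_ℂ + ⟪G l, mulOp w (G (j + 1))⟫_ℂ‖
        ≤ ħ ^ (l + 1 + j) * (‖⟪G l, mulOp w' (G j)⟫_ℂ‖ + ‖⟪G l, mulOp w (G (j + 1))⟫_ℂ‖) := by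
          gcongr; exact norm_add_le _ _
      _ = ħ ^ (l + 1 + j) * ‖⟪G l, mulOp w' (G j)⟫_ℂ‖
          + ħ ^ (l + (j + 1)) * ‖⟪G l, mulOp w (G (j + 1))⟫_ℂ‖ := by rw [mul_add, h4]
      _ ≤ _ := add_le_add h3 h2

lemma continuous_bracketWeightDeriv {κ : ℝ} (hκ : 0 < κ) : Continuous (bracketWeightDeriv κ) := by
  have hb : Continuous bracket := contDiff_bracket.continuous
  unfold bracketWeightDeriv
  refine Continuous.div (by
    refine ((continuous_id.div hb fun x => (bracket_pos x).ne').mul (by fun_prop)).sub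
      (hb.mul (by fun_prop))) (by fun_prop) fun x => by positivity

/-- Interpolation of the half weight between the moment of `u` and higher derivatives. -/
lemma eLpNorm_half_weight_le {ħ c : ℝ} (hħ : 0 < ħ) (hħ1 : ħ ≤ 1) {A : ℕ → ℝ}
    {G : ℕ → L2R} (hG : ∀ k, IsDer (G k) (G (k + 1))) (hA : ∀ k, ħ ^ k * ‖G k‖ ≤ A k)
    (hc : eLpNorm (fun x : ℝ => (bracket x : ℂ) * G 0 x) 2 volume ≤ ENNReal.ofReal c)
    (hc0 : 0 ≤ c) (k : ℕ) :
    eLpNorm (fun x : ℝ => ((bracket x ^ (1 / 2 : ℝ) : ℝ) : ℂ) * ((ħ : ℂ) ^ k * G k x)) 2 volume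
      ≤ ENNReal.ofReal (Real.sqrt (weightedBound A c k k)) := by
  have main : ∀ κ : ℝ, 0 < κ → κ ≤ 1 →
      eLpNorm (fun x : ℝ => (Real.sqrt (bracketWeight κ x) : ℂ) * ((ħ : ℂ) ^ k * G k x)) 2 volume
        ≤ ENNReal.ofReal (Real.sqrt (weightedBound A c k k)) := by
    intro κ hκ hκ1
    let w : ℝ →ᵇ ℂ := BoundedContinuousFunction.ofNormedAddCommGroup
      (fun x => (bracketWeight κ x : ℂ))
      (Complex.continuous_ofReal.comp (contDiff_bracketWeight hκ).continuous) κ⁻¹ (fun x => by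
        rw [Complex.norm_real, Real.norm_eq_abs, abs_of_nonneg (bracketWeight_nonneg hκ x)]
        exact bracketWeight_le_inv hκ hκ1 x)
    let w' : ℝ →ᵇ ℂ := BoundedContinuousFunction.ofNormedAddCommGroup
      (fun x => (bracketWeightDeriv κ x : ℂ))
      (Complex.continuous_ofReal.comp (continuous_bracketWeightDeriv hκ)) 3 (fun x => by
        rw [Complex.norm_real]; exact abs_bracketWeightDeriv_le hκ hκ1 x)
    let s : ℝ →ᵇ ℂ := BoundedContinuousFunction.ofNormedAddCommGroup
      (fun x => (Real.sqrt (bracketWeight κ x) : ℂ))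
      (Complex.continuous_ofReal.comp (contDiff_bracketWeight hκ).continuous.sqrt)
      (Real.sqrt κ⁻¹) (fun x => by
        rw [Complex.norm_real, Real.norm_eq_abs, abs_of_nonneg (Real.sqrt_nonneg _)]
        exact Real.sqrt_le_sqrt (bracketWeight_le_inv hκ hκ1 x))
    have hw0 : ‖mulOp (star w) (G 0)‖ ≤ c := by
      refine norm_le_of_eLpNorm_le hc0 (ae_eq_refl _) ((eLpNorm_mono_ae ?_).trans hc)
      filter_upwards [coeFn_mulOp (star w) (G 0)] with x hx
      rw [hx, norm_mul, norm_mul]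
      gcongr
      change ‖conj (bracketWeight κ x : ℂ)‖ ≤ _
      rw [RCLike.norm_conj, Complex.norm_real, Complex.norm_real, Real.norm_eq_abs,
        Real.norm_eq_abs, abs_of_nonneg (bracketWeight_nonneg hκ x), abs_of_pos (bracket_pos x)]
      exact bracketWeight_le hκ x
    have key := norm_inner_mulOp_le_weightedBound hħ hħ1 hG hA (w := w) (w' := w')
      (Complex.ofRealCLM.contDiff.comp (contDiff_bracketWeight hκ))
      (fun x => (hasDerivAt_bracketWeight hκ x).ofReal_comp)
      (fun x => by
        change ‖(bracketWeightDeriv κ x : ℂ)‖ ≤ 3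
        rw [Complex.norm_real]; exact abs_bracketWeightDeriv_le hκ hκ1 x) hw0 k k
    have hs : mulOp s (mulOp s (G k)) = mulOp w (G k) := by
      apply Lp.ext
      filter_upwards [coeFn_mulOp s (G k), coeFn_mulOp s (mulOp s (G k)), coeFn_mulOp w (G k)]
        with x h1 h2 h3
      rw [h2, h1, h3, ← mul_assoc]
      congr 1
      change (Real.sqrt (bracketWeight κ x) : ℂ) * (Real.sqrt (bracketWeight κ x) : ℂ)
        = (bracketWeight κ x : ℂ)
      rw [← Complex.ofReal_mul, Real.mul_self_sqrt (bracketWeight_nonneg hκ x)]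
    have hsq : ‖mulOp s (G k)‖ ^ 2 = ‖⟪G k, mulOp w (G k)⟫_ℂ‖ := by
      rw [← hs, inner_mulOp (w := s) (z := s) (fun x => (Complex.conj_ofReal _).symm),
        inner_self_eq_norm_sq_to_K, norm_pow, RCLike.norm_ofReal, abs_norm]
    have hnorm : ‖(ħ : ℂ) ^ k • mulOp s (G k)‖ ≤ Real.sqrt (weightedBound A c k k) := by
      refine Real.le_sqrt_of_sq_le ?_
      rw [norm_smul, norm_pow, Complex.norm_real, Real.norm_eq_abs, abs_of_pos hħ, mul_pow, hsq,
        ← pow_mul, mul_two]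
      exact key
    have hae : (fun x : ℝ => (Real.sqrt (bracketWeight κ x) : ℂ) * ((ħ : ℂ) ^ k * G k x))
        =ᵐ[volume] ((ħ : ℂ) ^ k • mulOp s (G k) : L2R) := by
      filter_upwards [Lp.coeFn_smul ((ħ : ℂ) ^ k) (mulOp s (G k)), coeFn_mulOp s (G k)]
        with x h1 h2
      rw [h1, Pi.smul_apply, h2, smul_eq_mul, mul_left_comm]; rfl
    rw [eLpNorm_eq_ofReal_norm hae]
    exact ENNReal.ofReal_le_ofReal hnorm
  refine Lp.eLpNorm_le_of_ae_tendsto (u := 𝓝[>] (0 : ℝ))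
    (f := fun κ x => (Real.sqrt (bracketWeight κ x) : ℂ) * ((ħ : ℂ) ^ k * G k x)) ?_ (fun κ => ?_)
    (Eventually.of_forall fun x => ?_)
  · filter_upwards [Ioc_mem_nhdsGT one_pos] with κ hκ using main κ hκ.1 hκ.2
  · have hb : Measurable (bracketWeight κ) := by
      have := contDiff_bracket.continuous.measurable
      unfold bracketWeight
      fun_prop
    exact (by fun_prop : Measurable fun x => (Real.sqrt (bracketWeight κ x) : ℂ)
      ).aestronglyMeasurable.mul ((Lp.aestronglyMeasurable _).const_mul _)
  · refine Tendsto.mul_const _ ?_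
    have : ContinuousAt (fun κ : ℝ => (Real.sqrt (bracketWeight κ x) : ℂ)) 0 := by
      unfold bracketWeight
      refine Complex.continuous_ofReal.continuousAt.comp (Real.continuous_sqrt.continuousAt.comp ?_)
      exact ContinuousAt.div (by fun_prop) (by fun_prop) (by simp)
    have h1 := this.tendsto.mono_left (nhdsWithin_le_nhds (s := Ioi 0))
    rw [← Real.sqrt_eq_rpow]
    simpa [bracketWeight] using h1

lemma eLpNorm_norm_sq (f : ℝ → ℂ) :
    eLpNorm (fun x => ‖f x‖ ^ 2) 1 volume = eLpNorm f 2 volume ^ 2 := by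
  have := eLpNorm_norm_rpow (μ := (volume : Measure ℝ)) (p := 1) f (q := 2) (by norm_num)
  simpa using this

lemma eLpNorm_bracket_sq_le {u : L2R} {a c : ℝ} (hu : ‖u‖ ≤ a) (hc0 : 0 ≤ c)
    (hc : eLpNorm (fun x : ℝ => (x : ℂ) * u x) 2 volume ≤ ENNReal.ofReal c) :
    eLpNorm (fun x : ℝ => bracket x ^ 2 * ‖u x‖ ^ 2) 1 volume
      ≤ ENNReal.ofReal (a ^ 2 + c ^ 2) := by
  have e : (fun x : ℝ => bracket x ^ 2 * ‖u x‖ ^ 2)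
      = (fun x => ‖u x‖ ^ 2) + fun x : ℝ => ‖(x : ℂ) * u x‖ ^ 2 := by
    ext x
    rw [Pi.add_apply, bracket_sq, norm_mul, Complex.norm_real, Real.norm_eq_abs, mul_pow, sq_abs]
    ring
  have ha0 : 0 ≤ a := (norm_nonneg _).trans hu
  have hm : AEStronglyMeasurable (fun x : ℝ => ‖(x : ℂ) * u x‖ ^ 2) volume :=
    ((Complex.continuous_ofReal.aestronglyMeasurable.mul
      (Lp.aestronglyMeasurable u)).norm.pow 2)
  have hm' : AEStronglyMeasurable (fun x : ℝ => ‖u x‖ ^ 2) volume :=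
    (Lp.aestronglyMeasurable u).norm.pow 2
  rw [e]
  refine (eLpNorm_add_le hm' hm le_rfl).trans ?_
  rw [eLpNorm_norm_sq, eLpNorm_norm_sq, eLpNorm_eq_ofReal_norm (ae_eq_refl u),
    ENNReal.ofReal_add (by positivity) (by positivity), ENNReal.ofReal_pow ha0,
    ENNReal.ofReal_pow hc0]
  gcongr

lemma eLpNorm_bracket_le {u : L2R} {a c : ℝ} (hu : ‖u‖ ≤ a) (hc0 : 0 ≤ c)
    (hc : eLpNorm (fun x : ℝ => (x : ℂ) * u x) 2 volume ≤ ENNReal.ofReal c) :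
    eLpNorm (fun x : ℝ => (bracket x : ℂ) * u x) 2 volume ≤ ENNReal.ofReal (a + c) := by
  have ha0 : 0 ≤ a := (norm_nonneg _).trans hu
  have hm : AEStronglyMeasurable (fun x : ℝ => ‖(x : ℂ) * u x‖) volume :=
    (Complex.continuous_ofReal.aestronglyMeasurable.mul (Lp.aestronglyMeasurable u)).norm
  have h1 : eLpNorm (fun x : ℝ => (bracket x : ℂ) * u x) 2 volume
      ≤ eLpNorm ((fun x => ‖u x‖) + fun x : ℝ => ‖(x : ℂ) * u x‖) 2 volume := by
    refine eLpNorm_mono fun x => ?_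
    rw [Pi.add_apply, norm_mul, norm_mul, Complex.norm_real, Complex.norm_real, Real.norm_eq_abs,
      Real.norm_eq_abs, Real.norm_eq_abs, abs_of_pos (bracket_pos x)]
    refine le_trans ?_ (le_abs_self _)
    nlinarith [bracket_le x, norm_nonneg (u x)]
  refine h1.trans ((eLpNorm_add_le (Lp.aestronglyMeasurable u).norm hm (by norm_num)).trans ?_)
  rw [eLpNorm_norm, eLpNorm_norm, eLpNorm_eq_ofReal_norm (ae_eq_refl u), ENNReal.ofReal_add ha0 hc0]
  gcongr

end

theorem lemma3p1 (C₀ : ℝ≥0) (T : ℝ) (hT : 0 ≤ T) :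
    ∃ (C : ℝ≥0) (D : ℕ → ℝ≥0) (D' : ℕ → ℝ≥0),
      ∀ (σ : ℝ), (σ = 1 ∨ σ = -1) →
      ∀ (ħ ε : ℝ), 0 < ħ → ħ ≤ 1 → 0 < ε →
      ∀ (ψin : Lp ℂ 2 (volume : Measure ℝ)) (ψ : ℝ → Lp ℂ 2 (volume : Measure ℝ)),
        IsAdmissibleDatum ħ C₀ ψin → IsHartreeSolution σ ħ ε T ψin ψ →
        ∀ t ∈ Icc 0 T,
          eLpNorm (fun x : ℝ => bracket x ^ 2 * ‖ψ t x‖ ^ 2) 1 volume ≤ C ∧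
          ∀ k : ℕ, ∃ g : ℝ → ℂ, HasWeakDeriv k (ψ t) g ∧
            eLpNorm (fun x : ℝ => (ħ : ℂ) ^ k * g x) 2 volume ≤ D k ∧
            (1 ≤ k →
              eLpNorm (fun x : ℝ => ((bracket x ^ (1 / 2 : ℝ) : ℝ) : ℂ) * ((ħ : ℂ) ^ k * g x))
                2 volume ≤ D' k) := by
  set c : ℝ := C₀ + T * (derivBound C₀ T 1 + 1) with hc
  refine ⟨(1 ^ 2 + c ^ 2).toNNReal, fun k => (derivBound C₀ T k).toNNReal,
    fun k => (Real.sqrt (weightedBound (derivBound C₀ T) (1 + c) k k)).toNNReal, ?_⟩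
  intro σ hσ ħ ε hħ hħ1 hε ψin ψ hin h t ht
  have hσ' : |σ| = 1 := by rcases hσ with rfl | rfl <;> simp
  have hc0 : 0 ≤ c := by
    have := derivBound_nonneg C₀.2 hT 1
    positivity
  obtain ⟨G, hG⟩ := h.exists_derivatives hσ' hħ hε hT hin
  have hnorm : ‖ψ t‖ ≤ 1 :=
    h.norm_iterate_dq_le hσ' hħ hε hT hin 0 0 le_rfl t ht 1 one_pos
  have hmom := h.eLpNorm_moment_le hσ' hħ hħ1 hε hT hin ht
  have hzero : G t 0 = ψ t := ((hG t ht 0).1).eq_of_zero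
  refine ⟨eLpNorm_bracket_sq_le hnorm hc0 hmom, fun k => ⟨G t k, (hG t ht k).1, ?_, fun _ => ?_⟩⟩
  · rw [eLpNorm_eq_ofReal_norm (const_mul_ae_eq_smul (ae_eq_refl _) _), norm_smul, norm_pow,
      Complex.norm_real, Real.norm_eq_abs, abs_of_pos hħ]
    exact ENNReal.ofReal_le_ofReal (hG t ht k).2
  · refine eLpNorm_half_weight_le hħ hħ1 (fun j => (hG t ht j).1.isDer (hG t ht (j + 1)).1)
      (fun j => (hG t ht j).2) ?_ (by positivity) k
    rw [hzero]
    exact eLpNorm_bracket_le hnorm hc0 hmom
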